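/- **Definitions.** A *plane digraph* $G$ is a finite directed multigraph (parallel edges and self-loops allowed) embedded in the plane: vertices are distinct points, edges are simple curves (simple closed curves for self-loops), and the interior of an edge meets neither a vertex nor another edge. A Jordan curve $\mathcal C$ is a *separator curve* of $G$ if (i) either each connected component of $G$ (ignoring directions) lies weakly inside $\mathcal C$ or strictly outside $\mathcal C$, or each connected component lies weakly outside $\mathcal C$ or strictly inside $\mathcal C$ ("weakly" means that points of $\mathcal C$ itself are allowed), and (ii) the interior of each edge is either a contiguous fragment of $\mathcal C$ or disjoint from $\mathcal C$. **Statement.** Let $G$ be a plane digraph, let $\mathcal C_1,\dots,\mathcal C_\ell$ be pairwise disjoint separator curves of $G$, and let $U=U_1\cup\dots\cup U_\ell$ be a set of $m$ vertices of $G$ such that the vertices of $U_i$ lie on $\mathcal C_i$. Let $\prec$ be a total order on $U$ in which each $U_i$ is contiguous and is sorted in the order in which the points of $\mathcal C_i$ are met when $\mathcal C_i$ is traversed once from some starting point (for instance clockwise). Let $A$ be the *reachability matrix* of $U$: the binary matrix with rows and columns indexed by $U$ in the order $\prec$, with $A_{u,v}=1$ if and only if $G$ has a directed path (possibly of length $0$)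 from $u$ to $v$. For $S,T\subseteq U$ let $A^{S,T}$ be the submatrix with row set $S$ and column set $T$; its *active columns* are the $t\in T$ with $A_{s,t}=1$ for some $s\in S$. Then $A$ can be partitioned into submatrices $A^{S_1,T_1},\dots,A^{S_k,T_k}$ such that, with constants in the $O$-notation that depend only on $\ell$: 1. for all $s,t\in U$ with $s\neq t$ there is exactly one $j$ with $s\in S_j$ and $t\in T_j$; 2. for each $j$, if $T_j'$ is the set of active columns of $A^{S_j,T_j}$, then the ones in each row of $A^{S_j,T_j'}$ (columns ordered by $\prec$) form $O(1)$ contiguous blocks; 3. each $s\in U$ lies in $O(\log m)$ of the sets $S_j$, and each $t\in U$ lies in $O(\log m)$ of the sets $T_j$. The sets $S_j,T_j$ do not depend on the entries of $A$: they are determined by $\ell$ and by the partition of the $\prec$-ordered positions $1,\dots,m$ into the sets $U_1,\dots,U_\ell$. There is one algorithm that, given $m$, $\ell$, for each position the index $i$ of the set $U_i$ containing it, and the $m\times m$ matrix $A$, outputs all the $S_j$, $T_j$ and the matrices $A^{S_j,T_j}$ in $O(m^2)$ time on a random access machine with words of $O(\log m)$ bits (for $m\le 1$, read $O(1)$ for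 the time and word-size bounds). -/

import Mathlib

open Set

/-! ## Jordan curves in the plane -/

/-- `γ`, restricted to `[0,1]`, is a simple closed parametrization of the plane set `C`.
The starting point and the direction of the traversal are arbitrary. -/
def IsJordanParam (γ : ℝ → ℂ) (C : Set ℂ) : Prop :=
  ContinuousOn γ (Icc 0 1) ∧ InjOn γ (Ico 0 1) ∧ γ 0 = γ 1 ∧ γ '' Icc 0 1 = C

/-- `C` is a Jordan curve. -/
def IsJordanCurve (C : Set ℂ) : Prop := ∃ γ : ℝ → ℂ, IsJordanParam γ C

/-- The union of the bounded connected components of the complement of `C`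
(for a Jordan curve there is exactly one). -/
def strictlyInside (C : Set ℂ) : Set ℂ :=
  {p | p ∉ C ∧ Bornology.IsBounded (connectedComponentIn Cᶜ p)}

/-- The union of the unbounded connected components of the complement of `C`
(for a Jordan curve there is exactly one). -/
def strictlyOutside (C : Set ℂ) : Set ℂ :=
  {p | p ∉ C ∧ ¬ Bornology.IsBounded (connectedComponentIn Cᶜ p)}

/-- The points `p x`, `x ∈ I`, lie on the Jordan curve `C`, and, as `x` increases, they are met in
this order when `C` is traversed once from a suitable starting point, in one of the two directions.
In particular this holds if they are sorted clockwise along `C`, from any first point. -/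
def ListedAlong {m : ℕ} (C : Set ℂ) (I : Set (Fin m)) (p : Fin m → ℂ) : Prop :=
  ∃ γ : ℝ → ℂ, IsJordanParam γ C ∧
    ∃ τ : Fin m → ℝ, StrictMonoOn τ I ∧ ∀ x ∈ I, τ x ∈ Ico (0 : ℝ) 1 ∧ γ (τ x) = p x

/-! ## Plane digraphs -/

/-- A plane embedded directed multigraph with vertex set `V` and edge set `E`; parallel edges and
self-loops are allowed.  Vertices are distinct points, edges are simple curves (simple closed curves
for loops) from source to target, and the interior of an edge contains no vertex and no point of
another edge. -/
structure PlaneDigraph (V E : Type*) where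
  src : E → V
  tgt : E → V
  pos : V → ℂ
  arc : E → ℝ → ℂ
  pos_injective : Function.Injective pos
  arc_continuousOn : ∀ e, ContinuousOn (arc e) (Icc 0 1)
  arc_zero : ∀ e, arc e 0 = pos (src e)
  arc_one : ∀ e, arc e 1 = pos (tgt e)
  arc_injOn : ∀ e, InjOn (arc e) (Ioo 0 1)
  arc_ne_pos : ∀ e, ∀ t ∈ Ioo (0 : ℝ) 1, ∀ v, arc e t ≠ pos v
  arc_disjoint : ∀ e f, e ≠ f → Disjoint (arc e '' Ioo 0 1) (arc f '' Ioo 0 1)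

namespace PlaneDigraph

variable {V E : Type*} (G : PlaneDigraph V E)

/-- There is a directed edge from `v` to `w`. -/
def Adj (v w : V) : Prop := ∃ e, G.src e = v ∧ G.tgt e = w

/-- There is a directed path (possibly of length `0`) from `v` to `w`. -/
def Reach (v w : V) : Prop := Relation.ReflTransGen G.Adj v w

/-- `v` and `w` are in the same connected component, edge directions being ignored. -/
def Linked (v w : V) : Prop := Relation.EqvGen G.Adj v w

/-- The set of points of the plane covered by the connected component of `v`. -/
def component (v : V) : Set ℂ :=
  {p | ∃ w, G.Linked v w ∧ p = G.pos w} ∪ {p | ∃ e, G.Linked v (G.src e) ∧ p ∈ G.arc e '' Icc 0 1}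

/-- `C` is a separator curve of `G`.  (The interior of an edge is connected, so it is a contiguous
fragment of `C` as soon as it is contained in `C`.) -/
def IsSeparatorCurve (C : Set ℂ) : Prop :=
  IsJordanCurve C ∧
  ((∀ v, G.component v ⊆ strictlyInside C ∪ C ∨ G.component v ⊆ strictlyOutside C) ∨
   (∀ v, G.component v ⊆ strictlyOutside C ∪ C ∨ G.component v ⊆ strictlyInside C)) ∧
  ∀ e, G.arc e '' Ioo 0 1 ⊆ C ∨ Disjoint (G.arc e '' Ioo 0 1) C

/-- `A` is the reachability matrix of the vertices `u 0, …, u (m - 1)`, with rows and columns in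
this order. -/
def IsReachMatrix {m : ℕ} (u : Fin m → V) (A : Matrix (Fin m) (Fin m) Bool) : Prop :=
  ∀ x y, A x y = true ↔ G.Reach (u x) (u y)

end PlaneDigraph

/-! ## Submatrices -/

/-- The active columns of the submatrix of `A` with row set `S` and column set `T`. -/
def activeCols {m : ℕ} (A : Matrix (Fin m) (Fin m) Bool) (S T : Finset (Fin m)) :
    Finset (Fin m) :=
  T.filter fun t => ∃ s ∈ S, A s t = true

/-- Among the columns in `T`, taken in increasing order, the ones of the row `r` form at most `k`
contiguous blocks. -/
def AtMostBlocks {m : ℕ} (k : ℕ) (T : Finset (Fin m)) (r : Fin m → Bool) : Prop :=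
  ∃ B : Finset (Fin m × Fin m), B.card ≤ k ∧
    ∀ t ∈ T, r t = true ↔ ∃ b ∈ B, b.1 ≤ t ∧ t ≤ b.2

/-- The entries of `A` in the listed rows and columns, row by row, as numbers `0` and `1`. -/
def entries {m : ℕ} (A : Matrix (Fin m) (Fin m) Bool) (S T : List (Fin m)) : List ℕ :=
  S.flatMap fun s => T.map fun t => (A s t).toNat

/-! ## A random access machine with a step count

Programs over finitely many registers and finitely many arrays of words, with the arithmetic
operations of a word RAM.  Each assignment, each memory access and each test takes one step. -/

namespace RAM

/-- Arithmetic operations. -/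
inductive Op where
  | add
  | sub
  | mul
  | div

/-- Their values; subtraction is truncated at `0`, and division by `0` gives `0`. -/
def Op.eval : Op → ℕ → ℕ → ℕ
  | .add, x, y => x + y
  | .sub, x, y => x - y
  | .mul, x, y => x * y
  | .div, x, y => x / y

/-- Programs.  Registers and arrays are named by natural numbers. -/
inductive Prog where
  | skip
  /-- `r := n` -/
  | const (r n : ℕ)
  /-- `r := x ∘ y` for registers `r, x, y` -/
  | arith (o : Op) (r x y : ℕ)
  /-- `r := a[x]` for registers `r, x` and an array `a` -/
  | load (r a x : ℕ)
  /-- `a[x] := y` for registers `x, y` and an array `a` -/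
  | store (a x y : ℕ)
  | seq (p q : Prog)
  /-- if `x < y` then `p` else `q` -/
  | cond (x y : ℕ) (p q : Prog)
  /-- while `x < y` do `p` -/
  | loop (x y : ℕ) (p : Prog)

/-- The contents of the registers and of the arrays. -/
structure Store where
  reg : ℕ → ℕ
  arr : ℕ → ℕ → ℕ

/-- Overwrite the register `r`. -/
def Store.setReg (σ : Store) (r v : ℕ) : Store :=
  { σ with reg := Function.update σ.reg r v }

/-- Overwrite the cell `i` of the array `a`. -/
def Store.setArr (σ : Store) (a i v : ℕ) : Store :=
  { σ with arr := Function.update σ.arr a (Function.update (σ.arr a) i v) }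

/-- `Runs W p σ t σ'`: started in `σ`, the program `p` halts after exactly `t` steps in `σ'`, and no
computed number exceeds the largest word `W` (there is no such run if an overflow occurs). -/
inductive Runs (W : ℕ) : Prog → Store → ℕ → Store → Prop
  | skip (σ : Store) : Runs W .skip σ 0 σ
  | const (σ : Store) (r n : ℕ) (h : n ≤ W) : Runs W (.const r n) σ 1 (σ.setReg r n)
  | arith (σ : Store) (o : Op) (r x y : ℕ) (h : o.eval (σ.reg x) (σ.reg y) ≤ W) :
      Runs W (.arith o r x y) σ 1 (σ.setReg r (o.eval (σ.reg x) (σ.reg y)))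
  | load (σ : Store) (r a x : ℕ) :
      Runs W (.load r a x) σ 1 (σ.setReg r (σ.arr a (σ.reg x)))
  | store (σ : Store) (a x y : ℕ) :
      Runs W (.store a x y) σ 1 (σ.setArr a (σ.reg x) (σ.reg y))
  | seq {p q : Prog} {σ₁ σ₂ σ₃ : Store} {t₁ t₂ : ℕ}
      (h₁ : Runs W p σ₁ t₁ σ₂) (h₂ : Runs W q σ₂ t₂ σ₃) : Runs W (.seq p q) σ₁ (t₁ + t₂) σ₃
  | cond_true {x y : ℕ} {p q : Prog} {σ σ' : Store} {t : ℕ} (h : σ.reg x < σ.reg y)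
      (hp : Runs W p σ t σ') : Runs W (.cond x y p q) σ (t + 1) σ'
  | cond_false {x y : ℕ} {p q : Prog} {σ σ' : Store} {t : ℕ} (h : ¬ σ.reg x < σ.reg y)
      (hq : Runs W q σ t σ') : Runs W (.cond x y p q) σ (t + 1) σ'
  | loop_true {x y : ℕ} {p : Prog} {σ₁ σ₂ σ₃ : Store} {t₁ t₂ : ℕ} (h : σ₁.reg x < σ₁.reg y)
      (h₁ : Runs W p σ₁ t₁ σ₂) (h₂ : Runs W (.loop x y p) σ₂ t₂ σ₃) :
      Runs W (.loop x y p) σ₁ (t₁ + t₂ + 1) σ₃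
  | loop_false {x y : ℕ} {p : Prog} {σ : Store} (h : ¬ σ.reg x < σ.reg y) :
      Runs W (.loop x y p) σ 1 σ

/-- The array `a` starts with the entries of `L`. -/
def Store.Holds (σ : Store) (a : ℕ) (L : List ℕ) : Prop :=
  ∀ (i : ℕ) (h : i < L.length), σ.arr a i = L[i]

/-- The input: register `0` holds `m`, register `1` holds `ℓ`, array `0` lists for each index the
number of the curve on which its vertex lies, and array `1` is the matrix, row by row.
Everything else is `0`. -/
def input {m ℓ : ℕ} (c : Fin m → Fin ℓ) (A : Matrix (Fin m) (Fin m) Bool) : Store where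
  reg r := if r = 0 then m else if r = 1 then ℓ else 0
  arr a i :=
    if a = 0 then (List.ofFn fun x => (c x : ℕ)).getD i 0
    else if a = 1 then (entries A (List.finRange m) (List.finRange m)).getD i 0
    else 0

/-- The output: the list of the submatrices of `A` with the row sets and column sets given by `P`.
Register `0` holds their number; arrays `2` and `3` hold their numbers of rows and of columns;
arrays `4`, `5`, `6` hold, one submatrix after the other, the sorted rows, the sorted columns
and the entries, row by row. -/
def IsOutput {m : ℕ} (A : Matrix (Fin m) (Fin m) Bool)
    (P : List (Finset (Fin m) × Finset (Fin m))) (σ : Store) : Prop :=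
  σ.reg 0 = P.length ∧
  σ.Holds 2 (P.map fun X => X.1.card) ∧
  σ.Holds 3 (P.map fun X => X.2.card) ∧
  σ.Holds 4 (P.flatMap fun X => X.1.sort.map Fin.val) ∧
  σ.Holds 5 (P.flatMap fun X => X.2.sort.map Fin.val) ∧
  σ.Holds 6 (P.flatMap fun X => entries A X.1.sort X.2.sort)

end RAM

/-! # Reachability matrices of plane digraphs -/

/-! ## Continuous logarithms -/

/-! The row and column sets come from dyadic halving. At each scale `2 ^ k` the positions are cut
into blocks of that length, and every block is paired with its sibling in the block of twice the
length. Two distinct positions are separated by blocks and merged one scale later at exactly one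
scale, so they share exactly one piece. A position occurs at most once per scale as a row and once
as a column, hence O(log m) times. Rows and columns of a piece are separated by the order.

This separation is what makes the rows structured. Suppose `s` reaches `t₁` and `t₃` but not `t₂`,
with `t₁ < t₂ < t₃` on one curve `C` and `t₂` active through a row `s'`. Walks of a plane digraph
meet only by sharing a vertex or an edge, and then the source of one reaches the target of the other
(`reach_of_mem_walkTrace`). So the walks from `s` to `t₁` and `t₃` avoid the walk from `s'` to `t₂`.
If `s'` lies on `C`, it is outside the interval from `t₁` to `t₃`, and two disjoint connections with
interleaved ends lie on one closed side of `C`, which is impossible (`reach_of_same_curve`). If `s'`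
lies on another curve `C'`, one such gap is possible. A second gap, `t₄ > t₃`, served from the same
`C'`, is not: the two sources on `C'` can be joined through the unused side of `C'`, which produces
a forbidden crossing again (`reach_of_disjoint_curve`). Colouring each column by its curve and by
the set of curves that serve a later gap on this curve therefore leaves at most one block per
colour, `ℓ * 2 ^ ℓ` in all.

The topology rests on continuous logarithms, obtained by lifting homotopies through the covering
`exp`. They show that an arc does not separate the plane, that a Jordan curve does, and that every
complementary component accumulates at the whole curve. The last fact makes all curve points
accessible from the unused side. The crossing lemma `exists_eq_of_accessible` then compares
increments of logarithms of differences of points: if the paths were disjoint, two increments with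
exponentials `-1` and `1` would agree.

The algorithm writes down the pieces without consulting the curve numbers. Scanning all `m`
positions for each block is affordable because the numbers of blocks decrease geometrically with the
scale, and the entries written at scale `w` number O(m w), again a geometric sum. -/

/-- A homotopy of nonvanishing functions transports continuous logarithms. -/
theorem exists_log_of_homotopy {A : Type*} [TopologicalSpace A] {s : Set A} {H : ℝ → A → ℂ}
    (hH : ContinuousOn (Function.uncurry H) (Icc 0 1 ×ˢ s))
    (hne : ∀ t ∈ Icc (0 : ℝ) 1, ∀ a ∈ s, H t a ≠ 0) {f : A → ℂ} (hf : ContinuousOn f s)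
    (h0 : ∀ a ∈ s, Complex.exp (f a) = H 0 a) :
    ∃ g : A → ℂ, ContinuousOn g s ∧ ∀ a ∈ s, Complex.exp (g a) = H 1 a := by
  classical
  let H' : C(unitInterval × s, {z : ℂ // z ≠ 0}) :=
    ⟨fun x => ⟨H x.1 x.2, hne _ x.1.2 _ x.2.2⟩, by
      refine Continuous.subtype_mk ?_ _
      exact hH.comp_continuous (f := fun x : unitInterval × s => ((x.1 : ℝ), (x.2 : A)))
        (by fun_prop) (fun x => ⟨x.1.2, x.2.2⟩)⟩
  let f' : C(s, ℂ) := ⟨fun a => f a, hf.domRestrict⟩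
  have h0' : ∀ a, H' (0, a) = (fun z : ℂ ↦ (⟨_, z.exp_ne_zero⟩ : {z : ℂ // z ≠ 0})) (f' a) :=
    fun a => Subtype.ext (h0 a a.2).symm
  -- `exp` is a covering of the punctured plane, so the homotopy lifts from the given logarithm at
  -- time `0`; the time-`1` slice is the answer, with the irrelevant value `0` off `s`.
  let L := Complex.isCoveringMap_exp.liftHomotopy H' f' h0'
  refine ⟨fun a => if h : a ∈ s then L (1, ⟨a, h⟩) else 0, ?_, fun a ha => ?_⟩
  · rw [continuousOn_iff_continuous_domRestrict]
    have : s.domRestrict (fun a => if h : a ∈ s then L (1, ⟨a, h⟩) else 0) = fun a => L (1, a) := by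
      ext a
      simp [Set.domRestrict]
    rw [this]
    fun_prop
  · have := congr_fun (Complex.isCoveringMap_exp.liftHomotopy_lifts H' f' h0') (1, ⟨a, ha⟩)
    have := congr_arg Subtype.val this
    simp only [ha, dif_pos]
    exact this

/-- A nonvanishing continuous function on a convex set has a continuous logarithm. -/
theorem Convex.exists_log {F : Type*} [NormedAddCommGroup F] [NormedSpace ℝ F] {s : Set F}
    (hs : Convex ℝ s) {f : F → ℂ} (hf : ContinuousOn f s) (hne : ∀ x ∈ s, f x ≠ 0) :
    ∃ g : F → ℂ, ContinuousOn g s ∧ ∀ x ∈ s, Complex.exp (g x) = f x := by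
  rcases s.eq_empty_or_nonempty with rfl | ⟨x₀, hx₀⟩
  · exact ⟨0, by simp, by simp⟩
  have hmem : ∀ t ∈ Icc (0 : ℝ) 1, ∀ a ∈ s, x₀ + t • (a - x₀) ∈ s := fun t ht a ha =>
    hs.add_smul_sub_mem hx₀ ha ht
  -- Contract the convex set to `x₀`; at time `0` the function is constant and has a constant
  -- logarithm.
  obtain ⟨g, hg, hge⟩ := exists_log_of_homotopy (s := s)
    (H := fun t a => f (x₀ + t • (a - x₀))) (f := fun _ => Complex.log (f x₀))
    (hf.comp (by fun_prop) fun x hx => hmem _ hx.1 _ hx.2)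
    (fun t ht a ha => hne _ (hmem t ht a ha)) continuousOn_const
    (fun a _ => by simp [Complex.exp_log (hne _ hx₀)])
  exact ⟨g, hg, fun x hx => by simpa using hge x hx⟩

/-- A continuous function with constant exponential on a preconnected set is constant. -/
theorem IsPreconnected.eq_of_exp_eq {A : Type*} [TopologicalSpace A] {s : Set A}
    (hs : IsPreconnected s) {g : A → ℂ} (hg : ContinuousOn g s) {w : ℂ}
    (he : ∀ a ∈ s, Complex.exp (g a) = w) {a b : A} (ha : a ∈ s) (hb : b ∈ s) : g a = g b :=
  Complex.isCoveringMap_exp.constOn_of_comp hs hg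
    (fun a ha a' ha' => Subtype.ext ((he a ha).trans (he a' ha').symm)) ha hb

/-- Two logarithms of the same function on a preconnected set have the same increments. -/
theorem IsPreconnected.sub_eq_of_exp_eq {A : Type*} [TopologicalSpace A] {s : Set A}
    (hs : IsPreconnected s) {g h : A → ℂ} (hg : ContinuousOn g s) (hh : ContinuousOn h s) {w : ℂ}
    (he : ∀ a ∈ s, Complex.exp (g a) = w * Complex.exp (h a)) {a b : A} (ha : a ∈ s)
    (hb : b ∈ s) : g a - g b = h a - h b := by
  have := hs.eq_of_exp_eq (hg.sub hh) (w := w)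
    (fun a ha => by
      simp [Complex.exp_sub, he a ha, Complex.exp_ne_zero]) ha hb
  simp only [Pi.sub_apply] at this
  linear_combination this

/-- If `o` and `b` are joined off `K`, then `(z - b) / (z - o)` has a continuous logarithm
on `K`. -/
theorem JoinedIn.exists_log {K : Set ℂ} {o b : ℂ} (h : JoinedIn Kᶜ o b) :
    ∃ g : ℂ → ℂ, ContinuousOn g K ∧ ∀ z ∈ K, Complex.exp (g z) * (z - o) = z - b := by
  obtain ⟨p, hp⟩ := h
  have hne : ∀ t : unitInterval, ∀ z ∈ K, z - p t ≠ 0 := fun t z hz h0 =>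
    hp t (by rwa [← sub_eq_zero.1 h0])
  have hne0 : ∀ z ∈ K, z - o ≠ 0 := fun z hz => by simpa using hne 0 z hz
  -- Move the zero of the numerator from `o` to `b` along the path, starting from the constant
  -- function `1`.
  obtain ⟨g, hg, hge⟩ := exists_log_of_homotopy (s := K)
    (H := fun t z => (z - p.extend t) / (z - o)) (f := fun _ => 0)
    (by
      refine ContinuousOn.div (by fun_prop) (by fun_prop) fun x hx => hne0 _ hx.2)
    (fun t ht a ha => div_ne_zero (by simpa [p.extend_apply ht] using hne ⟨t, ht⟩ a ha)
      (hne0 a ha))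
    continuousOn_const (fun a ha => by simp [div_self (hne0 a ha)])
  refine ⟨g, hg, fun z hz => ?_⟩
  rw [hge z hz]
  simp [div_mul_cancel₀ _ (hne0 z hz)]

/-- The identity of a circle has no continuous logarithm. -/
theorem not_exists_log_circle {L : ℂ → ℂ} {p : ℂ} {ρ : ℝ} (hρ : 0 < ρ)
    (hL : ContinuousOn L (Metric.sphere p ρ))
    (he : ∀ z ∈ Metric.sphere p ρ, Complex.exp (L z) = z - p) : False := by
  have hmem : ∀ θ, circleMap p ρ θ ∈ Metric.sphere p ρ := fun θ => circleMap_mem_sphere p hρ.le θ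
  -- Along the circle the logarithm must grow like `θ * I`, by a nonzero amount over a full turn,
  -- although it returns to its initial value.
  have := isPreconnected_univ.sub_eq_of_exp_eq (g := fun θ : ℝ => L (circleMap p ρ θ))
    (h := fun θ : ℝ => (θ : ℂ) * Complex.I) (w := ρ)
    ((hL.comp (continuous_circleMap p ρ).continuousOn fun θ _ => hmem θ)) (by fun_prop)
    (fun θ _ => by rw [he _ (hmem θ)]; simp [circleMap]) (mem_univ 0) (mem_univ (2 * Real.pi))
  have hper : circleMap p ρ (2 * Real.pi) = circleMap p ρ 0 := by
    simp [circleMap]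
  simp [hper, Real.pi_ne_zero] at this

/-! ## Crossing paths -/

/-- Let `γ` be a simple closed curve, with period `1`, and let `a < b < c < d < a + 1`.  If the
points `γ a`, `γ b`, `γ c`, `γ d` are accessible from a point `o` off the two paths, then a path from
`γ a` to `γ c` meets a path from `γ b` to `γ d`. -/
theorem exists_eq_of_accessible {γ : ℝ → ℂ} (hγ : Continuous γ) (hper : ∀ x, γ (x + 1) = γ x)
    (hinj : ∀ x y, x < y → y < x + 1 → γ x ≠ γ y) {a b c d : ℝ} (hab : a < b) (hbc : b < c)
    (hcd : c < d) (hda : d < a + 1) (P : Path (γ a) (γ c)) (Q : Path (γ b) (γ d))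
    {o : ℂ} (ho : o ∉ range γ)
    (ha : JoinedIn (range Q ∪ γ '' Icc b d)ᶜ o (γ a))
    (hb : JoinedIn (range P ∪ γ '' Icc c (a + 1))ᶜ o (γ b))
    (hc : JoinedIn (range Q ∪ γ '' Icc d (b + 1))ᶜ o (γ c))
    (hd : JoinedIn (range P ∪ γ '' Icc a c)ᶜ o (γ d)) : ∃ s t, P s = Q t := by
  by_contra! hPQ
  have hoP : ∀ s, P.extend s - o ≠ 0 := fun s h0 => by
    refine hb.mem.1 (Or.inl ?_)
    rw [← sub_eq_zero.1 h0]
    exact P.extend_range ▸ mem_range_self s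
  have hoQ : ∀ s, Q.extend s - o ≠ 0 := fun s h0 => by
    refine ha.mem.1 (Or.inl ?_)
    rw [← sub_eq_zero.1 h0]
    exact Q.extend_range ▸ mem_range_self s
  have hPm : ∀ s, P.extend s ∈ range P := fun s => P.extend_range ▸ mem_range_self s
  have hQm : ∀ s, Q.extend s ∈ range Q := fun s => Q.extend_range ▸ mem_range_self s
  have hPQ' : ∀ x : ℝ × ℝ, Q.extend x.2 - P.extend x.1 ≠ 0 := fun x h0 => by
    obtain ⟨s, hs⟩ := hPm x.1
    obtain ⟨t, ht⟩ := hQm x.2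
    exact hPQ s t (by rw [hs, ht, sub_eq_zero.1 h0])
  obtain ⟨ω, hω, hωe⟩ := (convex_univ (𝕜 := ℝ) (E := ℝ)).exists_log (f := fun x => γ x - o)
    (by fun_prop) (fun x _ h0 => ho ⟨x, sub_eq_zero.1 h0⟩)
  obtain ⟨α, hα, hαe⟩ := (convex_univ (𝕜 := ℝ) (E := ℝ)).exists_log
    (f := fun x => P.extend x - o) (by fun_prop) (fun x _ => hoP x)
  obtain ⟨β, hβ, hβe⟩ := (convex_univ (𝕜 := ℝ) (E := ℝ)).exists_log
    (f := fun x => Q.extend x - o) (by fun_prop) (fun x _ => hoQ x)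
  obtain ⟨Λ, hΛ, hΛe⟩ := (convex_univ (𝕜 := ℝ) (E := ℝ × ℝ)).exists_log
    (f := fun x => Q.extend x.2 - P.extend x.1) (by fun_prop) (fun x _ => hPQ' x)
  -- On this convex strip the chord `γ y - γ x` does not vanish, so it has a logarithm `M` without
  -- any further topology.
  set S : Set (ℝ × ℝ) := {p | p.1 < p.2 ∧ p.2 < p.1 + 1} with hS
  have hSc : Convex ℝ S := by
    intro p hp q hq u v hu hv huv
    simp only [hS, mem_ofPred_eq, Prod.fst_add, Prod.snd_add, Prod.smul_fst, Prod.smul_snd,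
      smul_eq_mul] at *
    rcases hu.eq_or_lt with rfl | hu
    · obtain rfl : v = 1 := by linarith
      constructor <;> linarith
    constructor <;> nlinarith
  obtain ⟨M, hM, hMe⟩ := hSc.exists_log (f := fun x => γ x.2 - γ x.1) (by fun_prop)
    (fun x hx h0 => hinj x.1 x.2 hx.1 hx.2 (sub_eq_zero.1 h0).symm)
  -- Accessibility of `γ a` from `o` lets the direction from `γ a` be compared with the direction
  -- from `o`, with one correction `la` valid both on `Q` and on the arc with the same ends;
  -- similarly for the other three points.
  obtain ⟨la, hla, hlae⟩ := ha.exists_log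
  obtain ⟨lb, hlb, hlbe⟩ := hb.exists_log
  obtain ⟨lc, hlc, hlce⟩ := hc.exists_log
  obtain ⟨ld, hld, hlde⟩ := hd.exists_log
  simp only [mem_univ, forall_const] at hωe hαe hβe hΛe
  rw [continuousOn_univ] at hω hα hβ hΛ
  -- the four sides of the square
  have s1 := isPreconnected_univ.sub_eq_of_exp_eq (g := fun s : ℝ => Λ (s, 0))
    (h := fun s => lb (P.extend s) + α s) (w := -1) (by fun_prop)
    (((hlb.mono subset_union_left).comp (by fun_prop) fun s _ => hPm s).add (by fun_prop))
    (fun s _ => by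
      rw [hΛe, Complex.exp_add, hαe, hlbe _ (Or.inl (hPm s))]; simp) (mem_univ 1) (mem_univ 0)
  have s2 := isPreconnected_univ.sub_eq_of_exp_eq (g := fun s : ℝ => Λ (s, 1))
    (h := fun s => ld (P.extend s) + α s) (w := -1) (by fun_prop)
    (((hld.mono subset_union_left).comp (by fun_prop) fun s _ => hPm s).add (by fun_prop))
    (fun s _ => by
      rw [hΛe, Complex.exp_add, hαe, hlde _ (Or.inl (hPm s))]; simp) (mem_univ 1) (mem_univ 0)
  have s3 := isPreconnected_univ.sub_eq_of_exp_eq (g := fun s : ℝ => Λ (0, s))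
    (h := fun s => la (Q.extend s) + β s) (w := 1) (by fun_prop)
    (((hla.mono subset_union_left).comp (by fun_prop) fun s _ => hQm s).add (by fun_prop))
    (fun s _ => by
      rw [hΛe, Complex.exp_add, hβe, hlae _ (Or.inl (hQm s))]; simp) (mem_univ 1) (mem_univ 0)
  have s4 := isPreconnected_univ.sub_eq_of_exp_eq (g := fun s : ℝ => Λ (1, s))
    (h := fun s => lc (Q.extend s) + β s) (w := 1) (by fun_prop)
    (((hlc.mono subset_union_left).comp (by fun_prop) fun s _ => hQm s).add (by fun_prop))
    (fun s _ => by
      rw [hΛe, Complex.exp_add, hβe, hlce _ (Or.inl (hQm s))]; simp) (mem_univ 1) (mem_univ 0)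
  -- the four arcs
  have r1 := (isPreconnected_Icc (a := c) (b := a + 1)).sub_eq_of_exp_eq (g := fun y => M (b, y))
    (h := fun y => lb (γ y) + ω y) (w := 1)
    (hM.comp (by fun_prop) fun y hy => ⟨by simp; linarith [hy.1], by simp; linarith [hy.2]⟩)
    (((hlb.mono subset_union_right).comp (by fun_prop) (mapsTo_image _ _)).add (by fun_prop))
    (fun y hy => by
      rw [hMe _ ⟨by simp; linarith [hy.1], by simp; linarith [hy.2]⟩, Complex.exp_add, hωe,
        hlbe _ (Or.inr (mem_image_of_mem _ hy)), one_mul])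
    (left_mem_Icc.2 (by linarith)) (right_mem_Icc.2 (by linarith))
  have r2 := (isPreconnected_Icc (a := a) (b := c)).sub_eq_of_exp_eq (g := fun y => M (y, d))
    (h := fun y => ld (γ y) + ω y) (w := -1)
    (hM.comp (by fun_prop) fun y hy => ⟨by simp; linarith [hy.2], by simp; linarith [hy.1]⟩)
    (((hld.mono subset_union_right).comp (by fun_prop) (mapsTo_image _ _)).add (by fun_prop))
    (fun y hy => by
      rw [hMe _ ⟨by simp; linarith [hy.2], by simp; linarith [hy.1]⟩, Complex.exp_add, hωe,
        hlde _ (Or.inr (mem_image_of_mem _ hy))]; simp)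
    (left_mem_Icc.2 (by linarith)) (right_mem_Icc.2 (by linarith))
  have r3 := (isPreconnected_Icc (a := b) (b := d)).sub_eq_of_exp_eq (g := fun y => M (a, y))
    (h := fun y => la (γ y) + ω y) (w := 1)
    (hM.comp (by fun_prop) fun y hy => ⟨by simp; linarith [hy.1], by simp; linarith [hy.2]⟩)
    (((hla.mono subset_union_right).comp (by fun_prop) (mapsTo_image _ _)).add (by fun_prop))
    (fun y hy => by
      rw [hMe _ ⟨by simp; linarith [hy.1], by simp; linarith [hy.2]⟩, Complex.exp_add, hωe,
        hlae _ (Or.inr (mem_image_of_mem _ hy)), one_mul])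
    (left_mem_Icc.2 (by linarith)) (right_mem_Icc.2 (by linarith))
  have r4 := (isPreconnected_Icc (a := d) (b := b + 1)).sub_eq_of_exp_eq (g := fun y => M (c, y))
    (h := fun y => lc (γ y) + ω y) (w := 1)
    (hM.comp (by fun_prop) fun y hy => ⟨by simp; linarith [hy.1], by simp; linarith [hy.2]⟩)
    (((hlc.mono subset_union_right).comp (by fun_prop) (mapsTo_image _ _)).add (by fun_prop))
    (fun y hy => by
      rw [hMe _ ⟨by simp; linarith [hy.1], by simp; linarith [hy.2]⟩, Complex.exp_add, hωe,
        hlce _ (Or.inr (mem_image_of_mem _ hy)), one_mul])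
    (left_mem_Icc.2 (by linarith)) (right_mem_Icc.2 (by linarith))
  -- the periods
  have e1 := isPreconnected_univ.sub_eq_of_exp_eq (g := fun x => ω (x + 1)) (h := ω) (w := 1)
    (by fun_prop) (by fun_prop) (fun x _ => by rw [hωe, hωe, hper, one_mul]) (mem_univ a)
    (mem_univ b)
  -- Exchanging the ends of a chord changes its sign, hence its logarithm by a constant on the
  -- strip.
  have e2 := hSc.isPreconnected.sub_eq_of_exp_eq (g := fun p => M (p.2, p.1 + 1)) (h := M)
    (w := -1)
    (hM.comp (by fun_prop) fun p hp => ⟨by simpa using hp.2, by simpa using hp.1⟩) hM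
    (fun p hp => by
      rw [hMe _ hp, hMe _ ⟨by simpa using hp.2, by simpa using hp.1⟩]; simp [hper])
    (a := (a, b)) (b := (b, c)) ⟨by simpa, by simp; linarith⟩ ⟨by simpa, by simp; linarith⟩
  simp only [Path.extend_zero, Path.extend_one, hper] at s1 s2 s3 s4 r1 r2 r3 r4 e1 e2
  -- The increments of `Λ` around the square sum to zero and those of `α` and `β` cancel. Each
  -- remaining correction is evaluated along an arc of the curve instead of along a path.
  have key : M (b, a + 1) - M (a, b) = ω (a + 1) - ω a := by
    linear_combination (1 / 2) * (s1 - s2 - s3 + s4 - r1 - r2 - r3 - r4 + e2 - e1)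
  have h1 : Complex.exp (M (b, a + 1) - M (a, b)) = -1 := by
    rw [Complex.exp_sub, hMe (b, a + 1) ⟨by simp; linarith, by simpa using hab⟩,
      hMe (a, b) ⟨by simpa, by simp; linarith⟩, hper]
    have := hinj a b hab (by linarith)
    rw [div_eq_iff (sub_ne_zero.2 this.symm)]
    ring
  have h2 : Complex.exp (ω (a + 1) - ω a) = 1 := by
    rw [Complex.exp_sub, hωe, hωe, hper, div_self]
    exact sub_ne_zero.2 fun h => ho ⟨a, h⟩
  rw [key, h2] at h1
  norm_num at h1

/-! ## The Jordan curve theorem -/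

/-- Components of an open plane set are open. A frontier point inside `F` would have a component
meeting the given one, hence equal to it, and would be an interior point. -/
theorem frontier_connectedComponentIn_subset {F : Set ℂ} (hF : IsOpen F) (p : ℂ) :
    frontier (connectedComponentIn F p) ⊆ Fᶜ := by
  intro z hz hzF
  have hz' : z ∉ connectedComponentIn F p := by
    have := hz.2
    rwa [(hF.connectedComponentIn (x := p)).interior_eq] at this
  have hn : connectedComponentIn F z ∈ nhds z := connectedComponentIn_mem_nhds (hF.mem_nhds hzF)
  obtain ⟨w, hw, hwp⟩ := mem_closure_iff_nhds.1 hz.1 _ hn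
  refine hz' ?_
  rw [connectedComponentIn_eq hwp, ← connectedComponentIn_eq hw]
  exact mem_connectedComponentIn hzF

/-- An arc has no bounded complementary component. -/
theorem not_isBounded_connectedComponentIn_compl_arc {e : ℝ → ℂ} {x y : ℝ}
    (he : ContinuousOn e (Icc x y)) (hinj : InjOn e (Icc x y)) {p : ℂ} (hp : p ∉ e '' Icc x y) :
    ¬ Bornology.IsBounded (connectedComponentIn (e '' Icc x y)ᶜ p) := by
  classical
  intro hb
  set K := e '' Icc x y with hK
  set R := connectedComponentIn Kᶜ p with hR
  have hKc : IsClosed K := (isCompact_Icc.image_of_continuousOn he).isClosed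
  have hpR : p ∈ R := mem_connectedComponentIn hp
  obtain ⟨ρ, hρ⟩ := hb.subset_ball p
  have hρ0 : 0 < ρ := by simpa using hρ hpR
  obtain ⟨l, hl, hle⟩ := (convex_Icc x y).exists_log (f := fun t => e t - p) (by fun_prop)
    (fun t ht h0 => hp ⟨t, ht, sub_eq_zero.1 h0⟩)
  have hemb : Topology.IsClosedEmbedding ((Icc x y).domRestrict e) :=
    Continuous.isClosedEmbedding he.domRestrict hinj.injective
  -- Tietze extension: the logarithm of `z - p` on the arc becomes a continuous function on the
  -- plane.
  obtain ⟨F, hF⟩ := ContinuousMap.exists_extension hemb ⟨(Icc x y).domRestrict l, hl.domRestrict⟩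
  have hFK : ∀ z ∈ K, Complex.exp (F z) = z - p := by
    rintro _ ⟨t, ht, rfl⟩
    have := congr_arg (fun f => f ⟨t, ht⟩) hF
    simp only [ContinuousMap.comp_apply, ContinuousMap.coe_mk, domRestrict_apply] at this
    rw [this, hle t ht]
  -- The two definitions agree on the frontier of `R`, which lies in the arc. Replacing `z - p` on
  -- `R` removes its only zero but leaves it unchanged on a large circle, where it has no logarithm.
  let r : ℂ → ℂ := fun z => if z ∈ R then Complex.exp (F z) else z - p
  have hr : Continuous r := by
    refine Continuous.if (fun a ha => hFK a ?_) (by fun_prop) (by fun_prop)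
    simpa using frontier_connectedComponentIn_subset hKc.isOpen_compl p ha
  have hr0 : ∀ z, r z ≠ 0 := fun z => by
    by_cases hz : z ∈ R
    · simp [r, hz, Complex.exp_ne_zero]
    · simp only [r, hz, if_false]
      exact fun h0 => hz (by rwa [sub_eq_zero.1 h0])
  obtain ⟨L, hL, hLe⟩ := (convex_univ (𝕜 := ℝ) (E := ℂ)).exists_log hr.continuousOn
    (fun z _ => hr0 z)
  refine not_exists_log_circle hρ0 (hL.mono (subset_univ (Metric.sphere p ρ))) fun z hz => ?_
  have hzR : z ∉ R := fun h => by
    have := hρ h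
    rw [Metric.mem_ball, Metric.mem_sphere.1 hz] at this
    exact this.false
  rw [hLe z (mem_univ z)]
  simp [r, hzR]

theorem isPreconnected_compl_ball (ρ : ℝ) :
    IsPreconnected (Metric.ball (0 : ℂ) ρ)ᶜ := by
  have : (Metric.ball (0 : ℂ) ρ)ᶜ =
      (fun x : ℝ × ℝ => (x.1 : ℂ) * Complex.exp (x.2 * Complex.I)) '' (Ici ρ ×ˢ univ) := by
    ext z
    simp only [mem_compl_iff, Metric.mem_ball, dist_zero_right, not_lt, mem_image, mem_prod,
      mem_Ici, mem_univ, and_true, Prod.exists]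
    constructor
    · exact fun h => ⟨‖z‖, z.arg, h, Complex.norm_mul_exp_arg_mul_I z⟩
    · rintro ⟨r, θ, hr, rfl⟩
      rw [norm_mul, Complex.norm_exp_ofReal_mul_I, mul_one, Complex.norm_real]
      exact hr.trans (le_abs_self r)
  rw [this]
  exact (isPreconnected_Ici.prod isPreconnected_univ).image _ (by fun_prop)

/-- A bounded set has only one unbounded complementary component. -/
theorem connectedComponentIn_compl_eq_of_not_isBounded {K : Set ℂ} (hK : Bornology.IsBounded K)
    {p q : ℂ} (hp : ¬ Bornology.IsBounded (connectedComponentIn Kᶜ p))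
    (hq : ¬ Bornology.IsBounded (connectedComponentIn Kᶜ q)) :
    connectedComponentIn Kᶜ p = connectedComponentIn Kᶜ q := by
  obtain ⟨ρ, hρ0, hρ⟩ := hK.subset_ball_lt 0 0
  -- An unbounded component leaves a ball containing `K`, so it contains the connected exterior of
  -- that ball.
  have key : ∀ w, ¬ Bornology.IsBounded (connectedComponentIn Kᶜ w) →
      (Metric.ball (0 : ℂ) ρ)ᶜ ⊆ connectedComponentIn Kᶜ w := fun w hw => by
    have : ¬ connectedComponentIn Kᶜ w ⊆ Metric.ball (0 : ℂ) ρ := fun h =>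
      hw (Metric.isBounded_ball.subset h)
    obtain ⟨z, hz, hzb⟩ := not_subset.1 this
    rw [connectedComponentIn_eq hz]
    exact (isPreconnected_compl_ball ρ).subset_connectedComponentIn hzb
      (compl_subset_compl.2 hρ)
  have hz : (ρ : ℂ) ∈ (Metric.ball (0 : ℂ) ρ)ᶜ := by simp [abs_of_pos hρ0]
  rw [connectedComponentIn_eq (key p hp hz), connectedComponentIn_eq (key q hq hz)]

theorem exists_not_isBounded_connectedComponentIn_compl {K : Set ℂ}
    (hK : Bornology.IsBounded K) :
    ∃ p, p ∉ K ∧ ¬ Bornology.IsBounded (connectedComponentIn Kᶜ p) := by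
  obtain ⟨ρ, hρ0, hρ⟩ := hK.subset_ball_lt 0 0
  have hz : (ρ : ℂ) ∈ (Metric.ball (0 : ℂ) ρ)ᶜ := by simp [abs_of_pos hρ0]
  refine ⟨ρ, fun h => hz (hρ h), fun hb => ?_⟩
  have h1 : (Metric.ball (0 : ℂ) ρ)ᶜ ⊆ connectedComponentIn Kᶜ (ρ : ℂ) :=
    (isPreconnected_compl_ball ρ).subset_connectedComponentIn hz (compl_subset_compl.2 hρ)
  have h2 : Bornology.IsBounded (univ : Set ℂ) := by
    rw [← compl_union_self (Metric.ball (0 : ℂ) ρ)]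
    exact (hb.subset h1).union Metric.isBounded_ball
  exact NormedSpace.unbounded_univ ℝ ℂ h2

/-- All components are unbounded, and a bounded set has only one unbounded complementary component.
-/
theorem isPreconnected_compl_arc {e : ℝ → ℂ} {x y : ℝ}
    (he : ContinuousOn e (Icc x y)) (hinj : InjOn e (Icc x y)) :
    IsPreconnected (e '' Icc x y)ᶜ := by
  have hK : Bornology.IsBounded (e '' Icc x y) :=
    (isCompact_Icc.image_of_continuousOn he).isBounded
  refine isPreconnected_of_forall_pair fun p hp q hq => ?_
  refine ⟨connectedComponentIn (e '' Icc x y)ᶜ p, connectedComponentIn_subset _ _,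
    mem_connectedComponentIn hp, ?_, isPreconnected_connectedComponentIn⟩
  rw [connectedComponentIn_compl_eq_of_not_isBounded hK
    (not_isBounded_connectedComponentIn_compl_arc he hinj hp)
    (not_isBounded_connectedComponentIn_compl_arc he hinj hq)]
  exact mem_connectedComponentIn hq

namespace IsJordanParam

variable {γ : ℝ → ℂ} {C : Set ℂ} (h : IsJordanParam γ C)

include h

theorem isCompact : IsCompact C := h.2.2.2 ▸ isCompact_Icc.image_of_continuousOn h.1

/-- This is the `1`-periodic extension of the parametrization, the form in which the crossing lemma
uses a closed curve. -/
theorem continuous_comp_fract : Continuous (γ ∘ Int.fract) :=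
  ContinuousOn.comp_fract'' h.1 h.2.2.1

theorem range_comp_fract : range (γ ∘ Int.fract) = C := by
  rw [← h.2.2.2]
  ext z
  constructor
  · rintro ⟨x, rfl⟩
    exact ⟨Int.fract x, ⟨Int.fract_nonneg x, (Int.fract_lt_one x).le⟩, rfl⟩
  · rintro ⟨x, hx, rfl⟩
    rcases hx.2.eq_or_lt with rfl | hx1
    · exact ⟨0, by simp [h.2.2.1]⟩
    · exact ⟨x, by simp [Int.fract_eq_self.2 ⟨hx.1, hx1⟩]⟩

theorem comp_fract_ne {x y : ℝ} (hxy : x < y) (hyx : y < x + 1) :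
    (γ ∘ Int.fract) x ≠ (γ ∘ Int.fract) y := by
  intro he
  have := h.2.1 ⟨Int.fract_nonneg x, Int.fract_lt_one x⟩ ⟨Int.fract_nonneg y, Int.fract_lt_one y⟩ he
  obtain ⟨z, hz⟩ := Int.fract_eq_fract.1 this
  have h1 : (z : ℝ) < 0 := by linarith
  have h2 : (-1 : ℝ) < z := by linarith
  have h1' : z < 0 := by exact_mod_cast h1
  have h2' : -1 < z := by exact_mod_cast h2
  omega

/-- A Jordan curve separates the plane. -/
theorem not_isPreconnected_compl : ¬ IsPreconnected Cᶜ := by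
  classical
  intro hC
  have hγ := h.1
  have half : (1 / 2 : ℝ) ∈ Ico (0 : ℝ) 1 := by constructor <;> norm_num
  have hab : γ 0 ≠ γ (1 / 2) := fun he => by
    have := h.2.1 ⟨le_rfl, one_pos⟩ half he
    norm_num at this
  set U := (γ '' Icc 0 (1 / 2))ᶜ with hU
  set V := (γ '' Icc (1 / 2) 1)ᶜ with hV
  have s1 : Icc (0 : ℝ) (1 / 2) ⊆ Icc 0 1 := Icc_subset_Icc_right (by norm_num)
  have s2 : Icc (1 / 2 : ℝ) 1 ⊆ Icc 0 1 := Icc_subset_Icc_left (by norm_num)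
  have hUo : IsOpen U := (isCompact_Icc.image_of_continuousOn (hγ.mono s1)).isClosed.isOpen_compl
  have hVo : IsOpen V := (isCompact_Icc.image_of_continuousOn (hγ.mono s2)).isClosed.isOpen_compl
  have hUne : ∀ z ∈ U, ∀ t ∈ Icc (0 : ℝ) (1 / 2), z - γ t ≠ 0 := fun z hz t ht h0 =>
    hz ⟨t, ht, (sub_eq_zero.1 h0).symm⟩
  have hVne : ∀ z ∈ V, ∀ t ∈ Icc (1 / 2 : ℝ) 1, z - γ t ≠ 0 := fun z hz t ht h0 =>
    hz ⟨t, ht, (sub_eq_zero.1 h0).symm⟩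
  have m1 : ∀ t ∈ Icc (0 : ℝ) 1, t / 2 ∈ Icc (0 : ℝ) (1 / 2) := fun t ht =>
    ⟨by linarith [ht.1], by linarith [ht.2]⟩
  have m2 : ∀ t ∈ Icc (0 : ℝ) 1, 1 - t / 2 ∈ Icc (1 / 2 : ℝ) 1 := fun t ht =>
    ⟨by linarith [ht.2], by linarith [ht.1]⟩
  -- Sliding the pole along the first half of the curve gives a logarithm of `(z - γ 0) / (z - γ (1
  -- / 2))` off that half; the second half gives another one, `k`.
  obtain ⟨g, hg, hge⟩ := exists_log_of_homotopy (s := U)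
    (H := fun t z => (z - γ 0) / (z - γ (t / 2))) (f := fun _ => 0)
    (ContinuousOn.div (by fun_prop)
      (continuousOn_snd.sub (hγ.comp (by fun_prop) fun x hx => s1 (m1 _ hx.1)))
      fun x hx => hUne _ hx.2 _ (m1 _ hx.1))
    (fun t ht z hz => div_ne_zero (hUne z hz 0 (by simp)) (hUne z hz _ (m1 t ht)))
    continuousOn_const
    (fun z hz => by simp [div_self (hUne z hz 0 (by simp))])
  obtain ⟨k, hk, hke⟩ := exists_log_of_homotopy (s := V)
    (H := fun t z => (z - γ 1) / (z - γ (1 - t / 2))) (f := fun _ => 0)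
    (ContinuousOn.div (by fun_prop)
      (continuousOn_snd.sub (hγ.comp (by fun_prop) fun x hx => s2 (m2 _ hx.1)))
      fun x hx => hVne _ hx.2 _ (m2 _ hx.1))
    (fun t ht z hz => div_ne_zero (hVne z hz 1 (by norm_num)) (hVne z hz _ (m2 t ht)))
    continuousOn_const
    (fun z hz => by simp [div_self (hVne z hz 1 (by norm_num))])
  have hhalf : (1 - 1 / 2 : ℝ) = 1 / 2 := by norm_num
  simp only [← h.2.2.1, hhalf] at hke
  have hCU : Cᶜ ⊆ U := compl_subset_compl.2 (h.2.2.2 ▸ image_mono s1)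
  have hCV : Cᶜ ⊆ V := compl_subset_compl.2 (h.2.2.2 ▸ image_mono s2)
  have hUV : U ∩ V ⊆ Cᶜ := by
    rintro z ⟨hzU, hzV⟩ hz
    rw [← h.2.2.2] at hz
    obtain ⟨t, ht, rfl⟩ := hz
    rcases le_total t (1 / 2) with h' | h'
    · exact hzU ⟨t, ⟨ht.1, h'⟩, rfl⟩
    · exact hzV ⟨t, ⟨h', ht.2⟩, rfl⟩
  have hcov : ∀ z, z ≠ γ 0 → z ≠ γ (1 / 2) → z ∈ U ∨ z ∈ V := by
    intro z hz0 hz1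
    by_contra! hz
    simp only [hU, hV, mem_compl_iff, not_not] at hz
    obtain ⟨⟨s, hs, hsz⟩, t, ht, htz⟩ := hz
    rcases ht.2.eq_or_lt with rfl | ht1
    · exact hz0 (by rw [h.2.2.1, htz])
    · have : s = t := h.2.1 ⟨hs.1, hs.2.trans_lt half.2⟩ ⟨half.1.trans ht.1, ht1⟩ (hsz.trans htz.symm)
      have : t = 1 / 2 := le_antisymm (this ▸ hs.2) ht.1
      exact hz1 (by rw [← htz, this])
  obtain ⟨z₀, hz₀, -⟩ := exists_not_isBounded_connectedComponentIn_compl h.isCompact.isBounded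
  set c := g z₀ - k z₀ with hc
  -- Here the assumed connectedness enters: the two logarithms differ by one constant on the whole
  -- complement, so they can be glued.
  have hgk : ∀ z ∈ Cᶜ, g z = k z + c := fun z hz => by
    have := hC.sub_eq_of_exp_eq (hg.mono hCU) (hk.mono hCV) (w := 1)
      (fun z hz => by rw [hge z (hCU hz), hke z (hCV hz), one_mul]) hz hz₀
    rw [hc]
    linear_combination this
  have hec : Complex.exp c = 1 := by
    rw [hc, Complex.exp_sub, hge z₀ (hCU hz₀), hke z₀ (hCV hz₀)]
    exact div_self (div_ne_zero (hUne _ (hCU hz₀) _ (by simp)) (hUne _ (hCU hz₀) _ (by simp)))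
  let G : ℂ → ℂ := fun z => if z ∈ U then g z else k z + c
  have hGV : ∀ z ∈ V, G z = k z + c := fun z hz => by
    by_cases hzU : z ∈ U
    · simp [G, hzU, hgk z (hUV ⟨hzU, hz⟩)]
    · simp [G, hzU]
  have hGU : ∀ z ∈ U, G z = g z := fun z hz => by simp [G, hz]
  have hGc : ∀ z, z ≠ γ 0 → z ≠ γ (1 / 2) → ContinuousAt G z := by
    intro z h0 h1
    rcases hcov z h0 h1 with hz | hz
    · exact (hg.continuousAt (hUo.mem_nhds hz)).congr
        (Filter.eventuallyEq_of_mem (hUo.mem_nhds hz) fun w hw => (hGU w hw).symm)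
    · exact ((hk.continuousAt (hVo.mem_nhds hz)).add continuousAt_const).congr
        (Filter.eventuallyEq_of_mem (hVo.mem_nhds hz) fun w hw => (hGV w hw).symm)
  have hGe : ∀ z, z ≠ γ 0 → z ≠ γ (1 / 2) →
      Complex.exp (G z) = (z - γ 0) / (z - γ (1 / 2)) := by
    intro z h0 h1
    rcases hcov z h0 h1 with hz | hz
    · rw [hGU z hz, hge z hz]
    · rw [hGV z hz, Complex.exp_add, hke z hz, hec, mul_one]
  set ρ := dist (γ 0) (γ (1 / 2)) / 2 with hρ
  have hρ0 : 0 < ρ := half_pos (dist_pos.2 hab)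
  have hbb : ∀ z ∈ Metric.closedBall (γ 0) ρ, z - γ (1 / 2) ≠ 0 := fun z hz h0 => by
    rw [sub_eq_zero.1 h0, Metric.mem_closedBall, dist_comm] at hz
    linarith
  obtain ⟨l, hl, hle⟩ := (convex_closedBall (γ 0) ρ).exists_log
    (f := fun z => z - γ (1 / 2)) (by fun_prop) hbb
  have hsp : ∀ z ∈ Metric.sphere (γ 0) ρ, z ≠ γ 0 ∧ z ≠ γ (1 / 2) := fun z hz =>
    ⟨fun h0 => by simp [h0] at hz; exact hρ0.ne hz,
      fun h1 => hbb z (Metric.sphere_subset_closedBall hz) (sub_eq_zero.2 h1)⟩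
  -- Near `γ 0` the denominator has a logarithm `l`, so the glued `G` would provide a logarithm of
  -- `z - γ 0` on a small circle.
  refine not_exists_log_circle (L := fun z => G z + l z) hρ0
    (ContinuousOn.add
      (fun z hz => (hGc z (hsp z hz).1 (hsp z hz).2).continuousWithinAt)
      (hl.mono Metric.sphere_subset_closedBall)) fun z hz => ?_
  rw [Complex.exp_add, hGe z (hsp z hz).1 (hsp z hz).2,
    hle z (Metric.sphere_subset_closedBall hz),
    div_mul_cancel₀ _ (hbb z (Metric.sphere_subset_closedBall hz))]

/-- Each point of a Jordan curve is a boundary point of each complementary component. -/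
theorem subset_closure_connectedComponentIn {p : ℂ} (hp : p ∉ C) :
    C ⊆ closure (connectedComponentIn Cᶜ p) := by
  set R := connectedComponentIn Cᶜ p with hR
  have hCo : IsOpen Cᶜ := h.isCompact.isClosed.isOpen_compl
  have hpR : p ∈ R := mem_connectedComponentIn hp
  by_contra hsub
  obtain ⟨x, hxC, hx⟩ := not_subset.1 hsub
  have hg := h.continuous_comp_fract
  have hgr := h.range_comp_fract
  have hgi := @comp_fract_ne _ _ h
  have hper : ∀ x, (γ ∘ Int.fract) (x + 1) = (γ ∘ Int.fract) x := fun x => by simp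
  set g := γ ∘ Int.fract
  rw [← hgr] at hxC
  obtain ⟨a, rfl⟩ := hxC
  obtain ⟨ε, hε, hball⟩ := Metric.mem_nhds_iff.1
    (hg.continuousAt.preimage_mem_nhds (isClosed_closure.isOpen_compl.mem_nhds hx))
  set η := min (ε / 2) (1 / 4) with hη
  have hη0 : 0 < η := by positivity
  have hηε : η < ε := (min_le_left _ _).trans_lt (by linarith)
  have hη4 : η ≤ 1 / 4 := min_le_right _ _
  have hnear : ∀ s, |s - a| ≤ η → g s ∉ closure R := fun s hs =>
    hball (by rw [Metric.mem_ball, Real.dist_eq]; linarith)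
  -- If `R` stays away from one point of the curve, it also stays away from a short arc around it,
  -- so its boundary lies in the complementary arc.
  have hmem : ∀ z ∈ C, z ∈ closure R → z ∈ g '' Icc (a + η) (a + 1 - η) := by
    intro z hzC hz
    rw [← hgr] at hzC
    obtain ⟨s, rfl⟩ := hzC
    have hs : g (a + Int.fract (s - a)) = g s := by
      simp only [g, Function.comp_apply]
      congr 1
      rw [Int.fract_eq_fract]
      exact ⟨-⌊s - a⌋, by rw [Int.fract]; push_cast; ring⟩
    have f0 := Int.fract_nonneg (s - a)
    have f1 := Int.fract_lt_one (s - a)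
    rw [← hs] at hz ⊢
    refine mem_image_of_mem _ ⟨?_, ?_⟩
    · by_contra! hlt
      exact hnear _ (by rw [abs_le]; constructor <;> linarith) hz
    · by_contra! hlt
      rw [← sub_add_cancel (a + Int.fract (s - a)) 1, hper] at hz
      exact hnear _ (by rw [abs_le]; constructor <;> linarith) hz
  have hginj : InjOn g (Icc (a + η) (a + 1 - η)) := by
    intro s hs t ht hst
    rcases lt_trichotomy s t with hlt | heq | hlt
    · exact absurd hst (hgi hlt (by linarith [hs.1, ht.2]))
    · exact heq
    · exact absurd hst.symm (hgi hlt (by linarith [hs.2, ht.1]))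
  have hpre := isPreconnected_compl_arc hg.continuousOn hginj
  have harc : g '' Icc (a + η) (a + 1 - η) ⊆ C := hgr ▸ image_subset_range _ _
  -- Off the complementary arc `R` is open and relatively closed. As an arc does not separate the
  -- plane, `R` fills everything off the arc, which contradicts that the curve separates.
  have hsubR := hpre.subset_of_closure_inter_subset (hCo.connectedComponentIn (x := p))
    ⟨p, fun hpa => hp (harc hpa), hpR⟩ (by
      rintro z ⟨hz, hza⟩
      by_contra hzR
      have hzf : z ∈ frontier R := ⟨hz, by rwa [hCo.connectedComponentIn.interior_eq]⟩
      have := frontier_connectedComponentIn_subset hCo p hzf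
      rw [compl_compl] at this
      exact hza (hmem z this hz))
  refine h.not_isPreconnected_compl ?_
  have : Cᶜ = R := ((compl_subset_compl.2 harc).trans hsubR).antisymm
    (connectedComponentIn_subset _ _)
  rw [this]
  exact isPreconnected_connectedComponentIn

end IsJordanParam

/-! ## The two sides of a Jordan curve -/

/-- The strict inside (for `true`) or the strict outside (for `false`) of a Jordan curve. -/
def curveSide (C : Set ℂ) (b : Bool) : Set ℂ :=
  {p | p ∉ C ∧ (Bornology.IsBounded (connectedComponentIn Cᶜ p) ↔ b = true)}

theorem curveSide_true (C : Set ℂ) : curveSide C true = strictlyInside C := by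
  simp [curveSide, strictlyInside]

theorem curveSide_false (C : Set ℂ) : curveSide C false = strictlyOutside C := by
  simp [curveSide, strictlyOutside]

theorem disjoint_curveSide (C : Set ℂ) (b : Bool) : Disjoint (curveSide C b) (curveSide C !b) := by
  rw [Set.disjoint_left]
  rintro p ⟨-, hp⟩ ⟨-, hq⟩
  rw [hp] at hq
  cases b <;> simp at hq

theorem disjoint_curveSide_self (C : Set ℂ) (b : Bool) : Disjoint (curveSide C b) C :=
  Set.disjoint_left.2 fun _ hp => hp.1

theorem IsPreconnected.subset_curveSide {C X : Set ℂ} (hX : IsPreconnected X)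
    (hd : Disjoint X C) {b : Bool} {x : ℂ} (hx : x ∈ X) (hxb : x ∈ curveSide C b) :
    X ⊆ curveSide C b := fun y hy => by
  have hXC : X ⊆ Cᶜ := hd.subset_compl_right
  refine ⟨hXC hy, ?_⟩
  rw [← connectedComponentIn_eq (hX.subset_connectedComponentIn hx hXC hy)]
  exact hxb.2

theorem connectedComponentIn_subset_curveSide {C : Set ℂ} {b : Bool} {p : ℂ}
    (hp : p ∈ curveSide C b) : connectedComponentIn Cᶜ p ⊆ curveSide C b :=
  isPreconnected_connectedComponentIn.subset_curveSide
    (disjoint_compl_left.mono_left (connectedComponentIn_subset _ _))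
    (mem_connectedComponentIn hp.1) hp

/-- The closure points of a connected open set are joined to each other off a closed set that they
and the open set avoid. -/
theorem JoinedIn.of_mem_closure {R K : Set ℂ} (hRo : IsOpen R) (hR : IsPreconnected R)
    (hK : IsClosed K) (hRK : Disjoint R K) {o z : ℂ} (ho : o ∈ R) (hz : z ∈ closure R)
    (hzK : z ∉ K) : JoinedIn Kᶜ o z := by
  obtain ⟨ε, hε, hball⟩ := Metric.isOpen_iff.1 hK.isOpen_compl z hzK
  obtain ⟨w, hwR, hw⟩ := Metric.mem_closure_iff.1 hz ε hε
  have h1 : JoinedIn R o w :=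
    ((hRo.isConnected_iff_isPathConnected).1 ⟨⟨o, ho⟩, hR⟩).joinedIn o ho w hwR
  have h2 : JoinedIn (Metric.ball z ε) w z :=
    ((convex_ball z ε).isPathConnected ⟨z, Metric.mem_ball_self hε⟩).joinedIn w
      (by rwa [Metric.mem_ball, dist_comm]) z (Metric.mem_ball_self hε)
  exact (h1.mono hRK.subset_compl_right).trans (h2.mono hball)

namespace IsJordanParam

variable {γ : ℝ → ℂ} {C : Set ℂ} (h : IsJordanParam γ C)

include h

theorem isPreconnected : IsPreconnected C := h.2.2.2 ▸ isPreconnected_Icc.image _ h.1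

theorem mem {t : ℝ} (ht0 : 0 ≤ t) (ht1 : t < 1) : γ t ∈ C :=
  h.2.2.2 ▸ mem_image_of_mem _ ⟨ht0, ht1.le⟩

/-- Without a bounded component all components would be the single unbounded one, and the curve
would not separate the plane. -/
theorem curveSide_nonempty (b : Bool) : (curveSide C b).Nonempty := by
  obtain ⟨p, hp, hpb⟩ := exists_not_isBounded_connectedComponentIn_compl h.isCompact.isBounded
  cases b
  · exact ⟨p, hp, by simpa using hpb⟩
  · by_contra hne
    rw [not_nonempty_iff_eq_empty, eq_empty_iff_forall_notMem] at hne
    have hall : ∀ q, q ∉ C → ¬ Bornology.IsBounded (connectedComponentIn Cᶜ q) := fun q hq hb =>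
      hne q ⟨hq, by simpa using hb⟩
    refine h.not_isPreconnected_compl ?_
    have : Cᶜ = connectedComponentIn Cᶜ p := by
      refine subset_antisymm (fun q hq => ?_) (connectedComponentIn_subset _ _)
      rw [connectedComponentIn_compl_eq_of_not_isBounded h.isCompact.isBounded hpb (hall q hq)]
      exact mem_connectedComponentIn hq
    rw [this]
    exact isPreconnected_connectedComponentIn

/-- A point of one open side of the curve, a connected open set around it inside this side, and the
fact that it accumulates at all points of the curve. -/
theorem exists_component (b : Bool) : ∃ R : Set ℂ, ∃ o ∈ R, IsOpen R ∧ IsPreconnected R ∧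
    R ⊆ curveSide C b ∧ C ⊆ closure R := by
  obtain ⟨o, ho⟩ := h.curveSide_nonempty b
  exact ⟨connectedComponentIn Cᶜ o, o, mem_connectedComponentIn ho.1,
    h.isCompact.isClosed.isOpen_compl.connectedComponentIn, isPreconnected_connectedComponentIn,
    connectedComponentIn_subset_curveSide ho, h.subset_closure_connectedComponentIn ho.1⟩

/-- On one closed side of a Jordan curve, two connections with interleaved ends on the curve meet. -/
theorem not_disjoint_of_joinedIn {a b c d : ℝ} (ha : 0 ≤ a) (hab : a < b) (hbc : b < c)
    (hcd : c < d) (hd : d < 1) {s : Bool} {P Q : Set ℂ} (hP : P ⊆ curveSide C s ∪ C)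
    (hQ : Q ⊆ curveSide C s ∪ C) (hPj : JoinedIn P (γ a) (γ c)) (hQj : JoinedIn Q (γ b) (γ d)) :
    ¬ Disjoint P Q := by
  intro hPQ
  -- The side opposite to `P` and `Q` is free. Its component `R` accumulates at every point of the
  -- curve, so each of the four ends is accessible from `o` through `R`.
  obtain ⟨R, o, hoR, hRo, hRc, hRs, hCR⟩ := h.exists_component (!s)
  have hg := h.continuous_comp_fract
  have hgr := h.range_comp_fract
  have hgi := @comp_fract_ne _ _ h
  have hper : ∀ x, (γ ∘ Int.fract) (x + 1) = (γ ∘ Int.fract) x := fun x => by simp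
  have hgγ : ∀ t, 0 ≤ t → t < 1 → γ t = (γ ∘ Int.fract) t := fun t h0 h1 => by
    simp [Int.fract_eq_self.2 ⟨h0, h1⟩]
  rw [hgγ a ha (by linarith), hgγ c (by linarith) (by linarith)] at hPj
  rw [hgγ b (by linarith) (by linarith), hgγ d (by linarith) hd] at hQj
  set g := γ ∘ Int.fract
  obtain ⟨p, hp⟩ := hPj
  obtain ⟨q, hq⟩ := hQj
  have hpP : range p ⊆ P := range_subset_iff.2 hp
  have hqQ : range q ⊆ Q := range_subset_iff.2 hq
  have hRside : Disjoint R (curveSide C s ∪ C) :=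
    disjoint_union_right.2 ⟨(disjoint_curveSide C s).symm.mono_left hRs,
      (disjoint_curveSide_self C _).mono_left hRs⟩
  have key : ∀ {A : Set ℂ} {x y z : ℝ}, IsCompact A → A ⊆ curveSide C s ∪ C → g z ∉ A →
      (∀ t ∈ Icc x y, g z ≠ g t) → JoinedIn (A ∪ g '' Icc x y)ᶜ o (g z) := by
    intro A x y z hAc hA hz hzt
    refine JoinedIn.of_mem_closure hRo hRc
      (hAc.union (isCompact_Icc.image hg)).isClosed
      (disjoint_union_right.2 ⟨hRside.mono_right hA, hRside.mono_right ?_⟩) hoR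
      (hCR (hgr ▸ mem_range_self z)) ?_
    · exact (hgr ▸ image_subset_range g _).trans subset_union_right
    · rintro (h' | ⟨t, ht, h'⟩)
      · exact hz h'
      · exact hzt t ht h'.symm
  have hdisj : ∀ z, z ∈ P → z ∈ Q → False := fun z h1 h2 => Set.disjoint_left.1 hPQ h1 h2
  have hga : g a ∈ P := by simpa using hp 0
  have hgc : g c ∈ P := by simpa using hp 1
  have hgb : g b ∈ Q := by simpa using hq 0
  have hgd : g d ∈ Q := by simpa using hq 1
  obtain ⟨u, v, huv⟩ := exists_eq_of_accessible hg hper (fun x y => hgi) hab hbc hcd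
    (by linarith) p q (o := o)
    (by rw [hgr]; exact fun ho => Set.disjoint_left.1 hRside hoR (Or.inr ho))
    (key (isCompact_range q.continuous) (hqQ.trans hQ) (fun h' => hdisj _ hga (hqQ h'))
      fun t ht => hgi (by linarith [ht.1]) (by linarith [ht.2]))
    (key (isCompact_range p.continuous) (hpP.trans hP) (fun h' => hdisj _ (hpP h') hgb)
      fun t ht => hgi (by linarith [ht.1]) (by linarith [ht.2]))
    (key (isCompact_range q.continuous) (hqQ.trans hQ) (fun h' => hdisj _ hgc (hqQ h'))
      fun t ht => hgi (by linarith [ht.1]) (by linarith [ht.2]))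
    (key (isCompact_range p.continuous) (hpP.trans hP) (fun h' => hdisj _ (hpP h') hgd)
      fun t ht => (hgi (by linarith [ht.2]) (by linarith [ht.1])).symm)
  exact hdisj (p u) (hp u) (huv ▸ hq v)

/-- Between two disjoint Jordan curves, a connection of two points of the first curve meets one of
two connections from the second curve to points of the first curve that the first two separate. -/
theorem not_disjoint_of_joinedIn_of_disjoint {γ' : ℝ → ℂ} {C' : Set ℂ}
    (h' : IsJordanParam γ' C') (hCC' : Disjoint C C') {a b c d : ℝ} (ha : 0 ≤ a) (hab : a < b)
    (hbc : b < c) (hcd : c < d) (hd : d < 1) {s s' : Bool} {P Q₁ Q₂ : Set ℂ} {z₁ z₂ : ℂ}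
    (hP : P ⊆ curveSide C s ∪ C) (hP' : P ⊆ curveSide C' s' ∪ C')
    (hQ₁ : Q₁ ⊆ curveSide C s ∪ C) (hQ₂ : Q₂ ⊆ curveSide C s ∪ C)
    (hPj : JoinedIn P (γ a) (γ c)) (hQj₁ : JoinedIn Q₁ z₁ (γ b)) (hQj₂ : JoinedIn Q₂ z₂ (γ d))
    (hz₁ : z₁ ∈ C') (hz₂ : z₂ ∈ C') (hPQ₁ : Disjoint P Q₁) (hPQ₂ : Disjoint P Q₂) : False := by
  obtain ⟨R, o, hoR, hRo, hRc, hRs, hCR⟩ := h'.exists_component (!s')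
  obtain ⟨p, hp⟩ := hPj
  have hpP : range p ⊆ P := range_subset_iff.2 hp
  have haC : γ a ∈ C := h.mem ha (by linarith)
  -- The connected curve `C` misses `C'` and has the point `γ a` in common with `P`, which fixes its
  -- side.
  have hCs' : C ⊆ curveSide C' s' := by
    refine h.isPreconnected.subset_curveSide hCC' haC ?_
    have : γ a ∈ curveSide C' s' ∪ C' := hP' (by simpa using hp 0)
    exact this.resolve_right (Set.disjoint_left.1 hCC' haC)
  have hRK : Disjoint R (range p ∪ C) := by
    have h1 : Disjoint R (curveSide C' s' ∪ C') :=
      disjoint_union_right.2 ⟨(disjoint_curveSide C' s').symm.mono_left hRs,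
        (disjoint_curveSide_self C' _).mono_left hRs⟩
    exact h1.mono_right (union_subset (hpP.trans hP') (hCs'.trans subset_union_left))
  have hK : IsClosed (range p ∪ C) :=
    ((isCompact_range p.continuous).union h.isCompact).isClosed
  have hn₁ : z₁ ∉ range p ∪ C := by
    rintro (h1 | h1)
    · exact Set.disjoint_left.1 hPQ₁ (hpP h1) hQj₁.source_mem
    · exact Set.disjoint_left.1 hCC' h1 hz₁
  have hn₂ : z₂ ∉ range p ∪ C := by
    rintro (h1 | h1)
    · exact Set.disjoint_left.1 hPQ₂ (hpP h1) hQj₂.source_mem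
    · exact Set.disjoint_left.1 hCC' h1 hz₂
  -- The detour from `z₁` to `z₂` runs through the free side of `C'` and near its two ends, avoiding
  -- both `P` and `C`. Inserted between `Q₁` and `Q₂`, it joins `γ b` to `γ d`.
  obtain ⟨x, hx⟩ := (JoinedIn.of_mem_closure hRo hRc hK hRK hoR (hCR hz₁) hn₁).symm.trans
    (JoinedIn.of_mem_closure hRo hRc hK hRK hoR (hCR hz₂) hn₂)
  have hxK : range x ⊆ (range p ∪ C)ᶜ := range_subset_iff.2 hx
  have hxs : range x ⊆ curveSide C s := by
    refine (isPreconnected_range x.continuous).subset_curveSide (x := z₁)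
      (Set.disjoint_left.2 fun w hw hwC => hxK hw (Or.inr hwC)) ⟨0, x.source⟩ ?_
    exact (hQ₁ hQj₁.source_mem).resolve_right (fun h1 => hn₁ (Or.inr h1))
  have hxj : JoinedIn (range x) z₁ z₂ := ⟨x, mem_range_self⟩
  refine h.not_disjoint_of_joinedIn ha hab hbc hcd hd (s := s) (P := range p)
    (Q := Q₁ ∪ range x ∪ Q₂) (hpP.trans hP)
    (union_subset (union_subset hQ₁ (hxs.trans subset_union_left)) hQ₂) ⟨p, mem_range_self⟩
    ((hQj₁.symm.mono (subset_union_left.trans subset_union_left)).trans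
      ((hxj.mono (subset_union_right.trans subset_union_left)).trans
        (hQj₂.mono subset_union_right))) ?_
  refine disjoint_union_right.2 ⟨disjoint_union_right.2 ⟨hPQ₁.mono_left hpP, ?_⟩,
    hPQ₂.mono_left hpP⟩
  exact Set.disjoint_left.2 fun w hw hwx => hxK hwx (Or.inl hw)

end IsJordanParam

/-! ## Reachability between separator curves -/

namespace PlaneDigraph

variable {V E : Type*} (G : PlaneDigraph V E)

/-- The points of the plane covered by the directed walks from `v` to `w`. -/
def walkTrace (v w : V) : Set ℂ :=
  {z | (∃ x, G.Reach v x ∧ G.Reach x w ∧ z = G.pos x) ∨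
    ∃ e, G.Reach v (G.src e) ∧ G.Reach (G.tgt e) w ∧ z ∈ G.arc e '' Ioo 0 1}

variable {G}

theorem Reach.linked {v w : V} (h : G.Reach v w) : G.Linked v w := by
  induction h with
  | refl => exact .refl _
  | tail _ hxy ih => exact .trans _ _ _ ih (.rel _ _ hxy)

theorem walkTrace_subset_component (v w : V) : G.walkTrace v w ⊆ G.component v := by
  rintro z (⟨x, hx, -, rfl⟩ | ⟨e, he, -, hz⟩)
  · exact Or.inl ⟨x, hx.linked, rfl⟩
  · exact Or.inr ⟨e, he.linked, image_mono Ioo_subset_Icc_self hz⟩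

theorem pos_mem_component {v w : V} (h : G.Reach v w) : G.pos w ∈ G.component v :=
  Or.inl ⟨w, h.linked, rfl⟩

/-- The trace collects all walks with the given ends, so no walk has to be chosen: prepending an
edge maps traces into traces. -/
theorem joinedIn_walkTrace {v w : V} (h : G.Reach v w) :
    JoinedIn (G.walkTrace v w) (G.pos v) (G.pos w) := by
  induction h using Relation.ReflTransGen.head_induction_on with
  | refl =>
    exact JoinedIn.refl (Or.inl ⟨w, Relation.ReflTransGen.refl, Relation.ReflTransGen.refl, rfl⟩)
  | head hadj hxw ih =>
    obtain ⟨e, rfl, rfl⟩ := hadj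
    have hst : G.Reach (G.src e) (G.tgt e) := Relation.ReflTransGen.single ⟨e, rfl, rfl⟩
    have hp : IsPathConnected (G.arc e '' Icc 0 1) :=
      ((convex_Icc (0 : ℝ) 1).isPathConnected ⟨0, by simp⟩).image' (G.arc_continuousOn e)
    have hj := hp.joinedIn (G.arc e 0) (mem_image_of_mem _ (by simp)) (G.arc e 1)
      (mem_image_of_mem _ (by simp))
    rw [G.arc_zero, G.arc_one] at hj
    refine (hj.mono ?_).trans (ih.mono ?_)
    · rintro z ⟨t, ht, rfl⟩
      rcases ht.1.eq_or_lt with rfl | h0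
      · exact Or.inl ⟨_, Relation.ReflTransGen.refl, hst.trans hxw, G.arc_zero e⟩
      rcases ht.2.eq_or_lt with rfl | h1
      · exact Or.inl ⟨_, hst, hxw, G.arc_one e⟩
      · exact Or.inr ⟨e, Relation.ReflTransGen.refl, hxw, t, ⟨h0, h1⟩, rfl⟩
    · rintro z (⟨x, hx, hx', hz⟩ | ⟨f, hf, hf', hz⟩)
      · exact Or.inl ⟨x, hst.trans hx, hx', hz⟩
      · exact Or.inr ⟨f, hst.trans hf, hf', hz⟩

/-- Walks that meet share a vertex. -/
theorem reach_of_mem_walkTrace {v w v' w' : V} {z : ℂ} (h : z ∈ G.walkTrace v w)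
    (h' : z ∈ G.walkTrace v' w') : G.Reach v w' := by
  rcases h with ⟨x, hx, -, rfl⟩ | ⟨e, he, -, t, ht, rfl⟩
  · rcases h' with ⟨y, -, hy, hxy⟩ | ⟨f, -, -, u, hu, hxu⟩
    · exact hx.trans (G.pos_injective hxy ▸ hy)
    · exact absurd hxu (G.arc_ne_pos f u hu x)
  · rcases h' with ⟨y, -, hy, hxy⟩ | ⟨f, -, hf', hz⟩
    · exact absurd hxy (G.arc_ne_pos e t ht y)
    · obtain rfl : e = f := by
        by_contra hef
        exact Set.disjoint_left.1 (G.arc_disjoint e f hef) (mem_image_of_mem _ ht) hz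
      exact he.trans (Relation.ReflTransGen.head ⟨e, rfl, rfl⟩ hf')

/-- This turns a zero of the matrix into disjointness in the plane, the hypothesis of the crossing
lemmas. -/
theorem disjoint_walkTrace {v w v' w' : V} (h : ¬ G.Reach v w') :
    Disjoint (G.walkTrace v w) (G.walkTrace v' w') :=
  Set.disjoint_left.2 fun _ hz hz' => h (reach_of_mem_walkTrace hz hz')

/-- The components that touch one closed side of a separator curve lie in it. -/
theorem IsSeparatorCurve.exists_side {C : Set ℂ} (h : G.IsSeparatorCurve C) :
    ∃ b, ∀ v, ∀ z ∈ G.component v, z ∈ curveSide C b ∪ C →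
      G.component v ⊆ curveSide C b ∪ C := by
  have key : ∀ b, (∀ v, G.component v ⊆ curveSide C b ∪ C ∨ G.component v ⊆ curveSide C !b) →
      ∀ v, ∀ z ∈ G.component v, z ∈ curveSide C b ∪ C → G.component v ⊆ curveSide C b ∪ C := by
    intro b hb v z hz hzC
    refine (hb v).resolve_right fun hv => ?_
    rcases hzC with h1 | h1
    · exact Set.disjoint_left.1 (disjoint_curveSide C b) h1 (hv hz)
    · exact (hv hz).1 h1
  rcases h.2.1 with h1 | h1
  · exact ⟨true, key true (by simpa [curveSide_true, curveSide_false] using h1)⟩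
  · exact ⟨false, key false (by simpa [curveSide_true, curveSide_false] using h1)⟩

section Alternation

variable {m : ℕ} {C : Set ℂ} {I : Set (Fin m)} {u : Fin m → V}

/-- Both walks start at `v`, so one can be traversed backwards; edge directions are irrelevant for
plane paths. -/
theorem joinedIn_walkTrace_union {v w w' : V} (h : G.Reach v w) (h' : G.Reach v w') :
    JoinedIn (G.walkTrace v w ∪ G.walkTrace v w') (G.pos w) (G.pos w') :=
  ((joinedIn_walkTrace h).symm.mono subset_union_left).trans
    ((joinedIn_walkTrace h').mono subset_union_right)

/-- Between two vertices reached from `s` there is no vertex that is missed by `s`, but reached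
from a vertex of the same curve outside the interval. -/
theorem reach_of_same_curve (hC : G.IsSeparatorCurve C)
    (hl : ListedAlong C I fun x => G.pos (u x)) {s s' t₁ t₂ t₃ : Fin m} (h₁ : t₁ ∈ I) (h₂ : t₂ ∈ I)
    (h₃ : t₃ ∈ I) (hs' : s' ∈ I) (h₁₂ : t₁ < t₂) (h₂₃ : t₂ < t₃) (hs : s' < t₁ ∨ t₃ < s')
    (r₁ : G.Reach (u s) (u t₁)) (r₃ : G.Reach (u s) (u t₃)) (r₂ : G.Reach (u s') (u t₂)) :
    G.Reach (u s) (u t₂) := by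
  by_contra hn
  obtain ⟨γ, hγ, τ, hτ, hτI⟩ := hl
  beta_reduce at hτI
  obtain ⟨b, hb⟩ := hC.exists_side
  have hcurve : ∀ x ∈ I, G.pos (u x) ∈ C := fun x hx => by
    rw [← (hτI x hx).2]
    exact hγ.mem (hτI x hx).1.1 (hτI x hx).1.2
  have hw : ∀ {v w : V} {x}, x ∈ I → G.Reach v (u x) →
      G.walkTrace v w ⊆ curveSide C b ∪ C := fun hx hr =>
    (walkTrace_subset_component _ _).trans
      (hb _ _ (pos_mem_component hr) (Or.inr (hcurve _ hx)))
  have hj := joinedIn_walkTrace_union r₁ r₃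
  have hj' := joinedIn_walkTrace r₂
  simp only [← (hτI _ h₁).2, ← (hτI _ h₂).2, ← (hτI _ h₃).2, ← (hτI _ hs').2] at hj hj'
  have hd : Disjoint (G.walkTrace (u s) (u t₁) ∪ G.walkTrace (u s) (u t₃))
      (G.walkTrace (u s') (u t₂)) :=
    disjoint_union_left.2 ⟨disjoint_walkTrace hn, disjoint_walkTrace hn⟩
  have hP := union_subset (hw (w := u t₁) h₁ r₁) (hw (w := u t₃) h₃ r₃)
  have hQ := hw (w := u t₂) h₂ r₂
  -- The four ends interleave in either case; which connection comes first depends on the position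
  -- of `s'`.
  rcases hs with hs | hs
  · exact hγ.not_disjoint_of_joinedIn (hτI _ hs').1.1 (hτ hs' h₁ hs) (hτ h₁ h₂ h₁₂)
      (hτ h₂ h₃ h₂₃) (hτI _ h₃).1.2 hQ hP hj' hj hd.symm
  · exact hγ.not_disjoint_of_joinedIn (hτI _ h₁).1.1 (hτ h₁ h₂ h₁₂) (hτ h₂ h₃ h₂₃)
      (hτ h₃ hs' hs) (hτI _ hs').1.2 hP hQ hj hj'.symm hd

/-- Vertices reached from `s` and vertices missed by `s`, but reached from another curve, do not
alternate twice. -/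
theorem reach_of_disjoint_curve {C' : Set ℂ} (hC : G.IsSeparatorCurve C)
    (hC' : G.IsSeparatorCurve C') (hCC' : Disjoint C C')
    (hl : ListedAlong C I fun x => G.pos (u x)) {s t₁ t₂ t₃ t₄ : Fin m} {v₂ v₄ : V}
    (h₁ : t₁ ∈ I) (h₂ : t₂ ∈ I) (h₃ : t₃ ∈ I) (h₄ : t₄ ∈ I) (h₁₂ : t₁ < t₂) (h₂₃ : t₂ < t₃)
    (h₃₄ : t₃ < t₄) (hv₂ : G.pos v₂ ∈ C') (hv₄ : G.pos v₄ ∈ C')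
    (r₁ : G.Reach (u s) (u t₁)) (r₃ : G.Reach (u s) (u t₃)) (r₂ : G.Reach v₂ (u t₂))
    (r₄ : G.Reach v₄ (u t₄)) : G.Reach (u s) (u t₂) ∨ G.Reach (u s) (u t₄) := by
  by_contra! hn
  obtain ⟨γ, hγ, τ, hτ, hτI⟩ := hl
  beta_reduce at hτI
  obtain ⟨γ', hγ'⟩ := hC'.1
  obtain ⟨b, hb⟩ := hC.exists_side
  obtain ⟨b', hb'⟩ := hC'.exists_side
  have hcurve : ∀ x ∈ I, G.pos (u x) ∈ C := fun x hx => by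
    rw [← (hτI x hx).2]
    exact hγ.mem (hτI x hx).1.1 (hτI x hx).1.2
  have hw : ∀ {v w : V} {x}, x ∈ I → G.Reach v (u x) →
      G.walkTrace v w ⊆ curveSide C b ∪ C := fun hx hr =>
    (walkTrace_subset_component _ _).trans
      (hb _ _ (pos_mem_component hr) (Or.inr (hcurve _ hx)))
  -- The component of `v₂` touches both curves, so `C` lies on the side of `C'` that carries the
  -- touching components. The walks from `s` touch `C` and hence are on that side too.
  have hC2 : C ⊆ curveSide C' b' := by
    refine hγ.isPreconnected.subset_curveSide hCC' (hcurve _ h₂) ?_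
    have := hb' v₂ _ (pos_mem_component Relation.ReflTransGen.refl) (Or.inr hv₂)
      (pos_mem_component r₂)
    exact this.resolve_right (Set.disjoint_left.1 hCC' (hcurve _ h₂))
  have hw' : ∀ w : V, G.walkTrace (u s) w ⊆ curveSide C' b' ∪ C' := fun w =>
    (walkTrace_subset_component _ _).trans
      (hb' _ _ (pos_mem_component r₁) (Or.inl (hC2 (hcurve _ h₁))))
  have hj := joinedIn_walkTrace_union r₁ r₃
  have hj₂ := joinedIn_walkTrace r₂
  have hj₄ := joinedIn_walkTrace r₄
  simp only [← (hτI _ h₁).2, ← (hτI _ h₂).2, ← (hτI _ h₃).2, ← (hτI _ h₄).2] at hj hj₂ hj₄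
  exact hγ.not_disjoint_of_joinedIn_of_disjoint hγ' hCC' (hτI _ h₁).1.1 (hτ h₁ h₂ h₁₂)
    (hτ h₂ h₃ h₂₃) (hτ h₃ h₄ h₃₄) (hτI _ h₄).1.2
    (union_subset (hw (w := u t₁) h₁ r₁) (hw (w := u t₃) h₃ r₃))
    (union_subset (hw' _) (hw' _)) (hw h₂ r₂) (hw h₄ r₄) hj hj₂ hj₄ hv₂ hv₄
    (disjoint_union_left.2 ⟨disjoint_walkTrace hn.1, disjoint_walkTrace hn.1⟩)
    (disjoint_union_left.2 ⟨disjoint_walkTrace hn.2, disjoint_walkTrace hn.2⟩)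

end Alternation

end PlaneDigraph

/-! ## Blocks -/

theorem AtMostBlocks.mono {m k k' : ℕ} {T : Finset (Fin m)} {r : Fin m → Bool}
    (h : AtMostBlocks k T r) (hk : k ≤ k') : AtMostBlocks k' T r := by
  obtain ⟨B, hB, hBT⟩ := h
  exact ⟨B, hB.trans hk, hBT⟩

/-- If no zero lies between two ones of the same colour, then there are at most as many blocks as
colours. -/
theorem atMostBlocks_of_colouring {m : ℕ} {κ : Type*} [Fintype κ] (T : Finset (Fin m))
    (r : Fin m → Bool) (f : Fin m → κ)
    (h : ∀ t₁ ∈ T, ∀ t₂ ∈ T, ∀ t₃ ∈ T, t₁ < t₂ → t₂ < t₃ → r t₁ = true → r t₃ = true →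
      f t₁ = f t₃ → r t₂ = true) : AtMostBlocks (Fintype.card κ) T r := by
  classical
  let F : κ → Finset (Fin m) := fun k => T.filter fun t => r t = true ∧ f t = k
  -- One block per colour, from the first to the last one of that colour.
  let B : κ → Finset (Fin m × Fin m) := fun k =>
    if h : (F k).Nonempty then {((F k).min' h, (F k).max' h)} else ∅
  refine ⟨Finset.univ.biUnion B, ?_, fun t ht => ⟨fun hr => ?_, ?_⟩⟩
  · refine (Finset.card_biUnion_le_card_mul _ _ 1 fun k _ => ?_).trans (by simp)
    by_cases hk : (F k).Nonempty <;> simp [B, hk]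
  · have hm : t ∈ F (f t) := by simp [F, ht, hr]
    have hne : (F (f t)).Nonempty := ⟨t, hm⟩
    exact ⟨_, Finset.mem_biUnion.2 ⟨f t, Finset.mem_univ _, by
      simp only [B, hne, dif_pos]; exact Finset.mem_singleton_self _⟩,
      Finset.min'_le _ _ hm, Finset.le_max' _ _ hm⟩
  · rintro ⟨b, hb, h1, h2⟩
    obtain ⟨k, -, hbk⟩ := Finset.mem_biUnion.1 hb
    by_cases hk : (F k).Nonempty
    · simp only [B, hk, dif_pos, Finset.mem_singleton] at hbk
      subst hbk
      have e1 := Finset.min'_mem _ hk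
      have e2 := Finset.max'_mem _ hk
      simp only [F, Finset.mem_filter] at e1 e2
      rcases h1.eq_or_lt with h1 | h1
      · exact h1 ▸ e1.2.1
      rcases h2.eq_or_lt with h2 | h2
      · exact h2 ▸ e2.2.1
      exact h _ e1.1 t ht _ e2.1 h1 h2 e1.2.1 e2.2.1 (e1.2.2.trans e2.2.2.symm)
    · simp [B, hk] at hbk

/-- In the reachability matrix of vertices on `ℓ` disjoint separator curves, a submatrix whose rows
all come before or all come after its columns has rows with few blocks in its active columns. -/
theorem PlaneDigraph.IsReachMatrix.atMostBlocks {V E : Type*} {G : PlaneDigraph V E} {m ℓ : ℕ}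
    {c : Fin m → Fin ℓ} (hc : ∀ i, (c ⁻¹' {i}).OrdConnected) {C : Fin ℓ → Set ℂ} {u : Fin m → V}
    {A : Matrix (Fin m) (Fin m) Bool} (hC : ∀ i, G.IsSeparatorCurve (C i))
    (hd : ∀ i j, i ≠ j → Disjoint (C i) (C j))
    (hl : ∀ i, ListedAlong (C i) (c ⁻¹' {i}) fun x => G.pos (u x)) (hA : G.IsReachMatrix u A)
    {S T : Finset (Fin m)}
    (hST : (∀ s ∈ S, ∀ t ∈ T, s < t) ∨ ∀ s ∈ S, ∀ t ∈ T, t < s) (s : Fin m) :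
    AtMostBlocks (ℓ * 2 ^ ℓ) (activeCols A S T) (A s) := by
  classical
  have hon : ∀ x, G.pos (u x) ∈ C (c x) := fun x => by
    obtain ⟨γ, hγ, τ, -, hτ⟩ := hl (c x)
    obtain ⟨h1, h2⟩ := hτ x rfl
    beta_reduce at h2
    exact h2 ▸ hγ.mem h1.1 h1.2
  -- The second component of the colour records the curves from which a row reaches a later active
  -- zero of row `s` on the same curve as `t`.
  let f : Fin m → Fin ℓ × Finset (Fin ℓ) := fun t => (c t, Finset.univ.filter fun i =>
    ∃ z ∈ activeCols A S T, t < z ∧ c z = c t ∧ A s z = false ∧ ∃ s' ∈ S, c s' = i ∧ A s' z = true)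
  have := atMostBlocks_of_colouring (activeCols A S T) (A s) f ?_
  · simpa using this
  intro t₁ ht₁ t₂ ht₂ t₃ ht₃ h₁₂ h₂₃ r₁ r₃ hf
  by_contra r₂
  have hc₃ : c t₃ = c t₁ := (congr_arg Prod.fst hf).symm
  have hc₂ : c t₂ = c t₁ := (hc (c t₁)).out (show c t₁ = c t₁ from rfl) hc₃ ⟨h₁₂.le, h₂₃.le⟩
  have hmem : ∀ {t}, t ∈ activeCols A S T → t ∈ T := fun h => (Finset.mem_filter.1 h).1
  obtain ⟨s', hs', rs'⟩ := (Finset.mem_filter.1 ht₂).2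
  by_cases hcs : c s' = c t₁
  · refine r₂ ((hA _ _).2 (G.reach_of_same_curve (hC (c t₁)) (hl (c t₁)) (s' := s') rfl hc₂ hc₃ hcs
      h₁₂ h₂₃ ?_ ((hA _ _).1 r₁) ((hA _ _).1 r₃) ((hA _ _).1 rs')))
    -- The separation of rows and columns places `s'` outside the interval from `t₁` to `t₃`.
    exact hST.imp (fun h => h _ hs' _ (hmem ht₁)) (fun h => h _ hs' _ (hmem ht₃))
  · have hi : c s' ∈ (f t₁).2 := by
      simp only [f, Finset.mem_filter, Finset.mem_univ, true_and]
      exact ⟨t₂, ht₂, h₁₂, hc₂, by simpa using r₂, s', hs', rfl, rs'⟩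
    -- The gap at `t₂` puts the curve of `s'` into the colour of `t₁`. As `t₃` has the same colour,
    -- there is a second gap after `t₃` served from that curve.
    rw [hf] at hi
    simp only [f, Finset.mem_filter, Finset.mem_univ, true_and] at hi
    obtain ⟨z, hz, h₃z, hcz, rz, s'', hs'', hcs'', rs''⟩ := hi
    rcases G.reach_of_disjoint_curve (hC (c t₁)) (hC (c s')) (hd _ _ (Ne.symm hcs)) (hl (c t₁))
      (v₂ := u s') (v₄ := u s'') rfl hc₂ hc₃ (hcz.trans hc₃) h₁₂ h₂₃ h₃z (hon s')
      (hcs'' ▸ hon s'') ((hA _ _).1 r₁) ((hA _ _).1 r₃) ((hA _ _).1 rs') ((hA _ _).1 rs'')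
      with h | h
    · exact r₂ ((hA _ _).2 h)
    · simp [(hA _ _).2 h] at rz

/-! ## The dyadic partition -/

/-- The block number `b` of the division of `Fin m` into blocks of length `w`. -/
def dyadicBlock (m w b : ℕ) : Finset (Fin m) := Finset.univ.filter fun x => (x : ℕ) / w = b

/-- The other number with the same half. -/
def sibling (b : ℕ) : ℕ := 4 * (b / 2) + 1 - b

/-- Each block of length `w` together with its sibling. -/
def dyadicPieces (m w : ℕ) : List (Finset (Fin m) × Finset (Fin m)) :=
  (List.range (m / w + 1)).map fun b => (dyadicBlock m w b, dyadicBlock m w (sibling b))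

/-- The pairs of sibling blocks at all scales. -/
def dyadicPartition (m : ℕ) : List (Finset (Fin m) × Finset (Fin m)) :=
  (List.range (Nat.clog 2 m)).flatMap fun k => dyadicPieces m (2 ^ k)

theorem mem_dyadicBlock {m w b : ℕ} {x : Fin m} : x ∈ dyadicBlock m w b ↔ (x : ℕ) / w = b := by
  simp [dyadicBlock]

theorem sibling_eq_iff {a b : ℕ} : a = sibling b ↔ a ≠ b ∧ a / 2 = b / 2 := by
  unfold sibling
  omega

theorem sibling_comm {a b : ℕ} : a = sibling b ↔ b = sibling a := by
  rw [sibling_eq_iff, sibling_eq_iff, ne_comm, eq_comm (a := a / 2)]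

/-- Siblings are distinct blocks with a common parent; this criterion isolates the unique scale of a
pair of positions. -/
theorem eq_sibling_div_iff {s t k : ℕ} : t / 2 ^ k = sibling (s / 2 ^ k) ↔
    t / 2 ^ k ≠ s / 2 ^ k ∧ t / 2 ^ (k + 1) = s / 2 ^ (k + 1) := by
  rw [sibling_eq_iff, pow_succ, Nat.div_div_eq_div_mul, Nat.div_div_eq_div_mul]

theorem div_pow_eq_of_le {s t k l : ℕ} (h : t / 2 ^ k = s / 2 ^ k) (hkl : k ≤ l) :
    t / 2 ^ l = s / 2 ^ l := by
  obtain ⟨d, rfl⟩ := Nat.exists_eq_add_of_le hkl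
  rw [pow_add, ← Nat.div_div_eq_div_mul, ← Nat.div_div_eq_div_mul, h]

/-- Counting is additive over the concatenated scales, which is easier to handle than list indices.
-/
theorem List.existsUnique_get_of_countP_eq_one {α : Type*} {p : α → Prop} [DecidablePred p]
    {L : List α} (h : L.countP (fun x => p x) = 1) : ∃! j : Fin L.length, p (L.get j) := by
  induction L with
  | nil => simp at h
  | cons a l ih =>
    by_cases ha : p a
    · rw [List.countP_cons_of_pos (by simpa using ha), Nat.add_eq_right, List.countP_eq_zero] at h
      refine ⟨⟨0, by simp⟩, ha, fun j hj => ?_⟩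
      induction j using Fin.cases with
      | zero => rfl
      | succ i => exact absurd hj (by simpa using h _ (List.get_mem l i))
    · rw [List.countP_cons_of_neg (by simpa using ha)] at h
      obtain ⟨j, hj, hju⟩ := ih h
      refine ⟨j.succ, hj, fun i hi => ?_⟩
      induction i using Fin.cases with
      | zero => exact absurd hi ha
      | succ i => rw [hju i hi]

theorem List.countP_range_eq (n a : ℕ) :
    (List.range n).countP (fun b => decide (a = b)) = if a < n then 1 else 0 := by
  have : (List.range n).countP (fun b => decide (a = b)) = (List.range n).count a := by
    rw [List.count]
    exact List.countP_congr fun b _ => by rw [beq_iff_eq, decide_eq_true_iff, eq_comm]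
  rw [this, List.nodup_range.count]
  simp

theorem List.sum_map_range_ite (n a : ℕ) :
    ((List.range n).map fun b => if a = b then 1 else 0).sum = if a < n then 1 else 0 := by
  induction n with
  | zero => simp
  | succ n ih =>
    simp only [List.range_succ, List.map_append, List.sum_append, ih, List.map_cons, List.map_nil,
      List.sum_cons, List.sum_nil]
    grind

theorem List.countP_flatMap_range_le {α : Type*} (p : α → Bool) (f : ℕ → List α) (n : ℕ)
    (h : ∀ k, (f k).countP p ≤ 1) : ((List.range n).flatMap f).countP p ≤ n := by
  induction n with
  | zero => simp
  | succ n ih =>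
    rw [List.range_succ, List.flatMap_append, List.countP_append]
    have := h n
    simp only [List.flatMap_cons, List.flatMap_nil, List.append_nil]
    omega

theorem countP_dyadicPieces_row (m w : ℕ) (s : Fin m) :
    (dyadicPieces m w).countP (fun X => s ∈ X.1) ≤ 1 := by
  rw [dyadicPieces, List.countP_map]
  refine le_trans (List.countP_mono_left (q := fun b => decide ((s : ℕ) / w = b)) ?_) ?_
  · intro b _ hb
    simpa [mem_dyadicBlock] using hb
  · rw [List.countP_range_eq]
    split_ifs <;> simp

/-- Taking siblings is an involution, so the column block of `t` determines the row block of the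
piece. -/
theorem countP_dyadicPieces_col (m w : ℕ) (t : Fin m) :
    (dyadicPieces m w).countP (fun X => t ∈ X.2) ≤ 1 := by
  rw [dyadicPieces, List.countP_map]
  refine le_trans (List.countP_mono_left (q := fun b => decide (sibling ((t : ℕ) / w) = b)) ?_) ?_
  · intro b _ hb
    simp only [Function.comp_apply, mem_dyadicBlock, decide_eq_true_eq] at hb ⊢
    exact (sibling_comm.1 hb).symm
  · rw [List.countP_range_eq]
    split_ifs <;> simp

/-- For `m ≥ 2`, rounding up costs at most another `log m`, so `clog * log 2 ≤ 2 * log m`, and `log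
2 > 1 / 2`. For `m ≤ 1` both sides vanish. -/
theorem clog_two_le_log (m : ℕ) : (Nat.clog 2 m : ℝ) ≤ 4 * Real.log m := by
  rcases Nat.lt_or_ge m 2 with h | h
  · rw [Nat.clog_of_right_le_one (by omega)]
    simpa using Real.log_natCast_nonneg m
  · have h1 : 2 ^ (Nat.clog 2 m - 1) < m := Nat.pow_pred_clog_lt_self (by norm_num) (by omega)
    have hpos : 0 < Nat.clog 2 m := Nat.clog_pos (by norm_num) h
    have h2 : Real.log ((2 : ℝ) ^ (Nat.clog 2 m - 1)) ≤ Real.log m :=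
      Real.log_le_log (by positivity) (by exact_mod_cast h1.le)
    have h3 : Real.log 2 ≤ Real.log m := Real.log_le_log (by norm_num) (by exact_mod_cast h)
    rw [Real.log_pow, Nat.cast_sub hpos] at h2
    push_cast at h2
    have := Real.log_two_gt_d9
    nlinarith [(Nat.cast_nonneg (Nat.clog 2 m) : (0 : ℝ) ≤ _)]

theorem countP_dyadicPartition_row (m : ℕ) (s : Fin m) :
    ((dyadicPartition m).countP (fun X => s ∈ X.1) : ℝ) ≤ 4 * Real.log m :=
  le_trans (Nat.cast_le.2 (List.countP_flatMap_range_le _ _ _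
    fun k => countP_dyadicPieces_row m (2 ^ k) s)) (clog_two_le_log m)

theorem countP_dyadicPartition_col (m : ℕ) (t : Fin m) :
    ((dyadicPartition m).countP (fun X => t ∈ X.2) : ℝ) ≤ 4 * Real.log m :=
  le_trans (Nat.cast_le.2 (List.countP_flatMap_range_le _ _ _
    fun k => countP_dyadicPieces_col m (2 ^ k) t)) (clog_two_le_log m)

theorem countP_dyadicPieces_cell (m w : ℕ) (s t : Fin m) :
    (dyadicPieces m w).countP (fun X => s ∈ X.1 ∧ t ∈ X.2) =
      if (t : ℕ) / w = sibling ((s : ℕ) / w) then 1 else 0 := by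
  rw [dyadicPieces, List.countP_map]
  split_ifs with h
  · have h1 := List.countP_range_eq (m / w + 1) ((s : ℕ) / w)
    rw [if_pos (Nat.lt_succ_of_le (Nat.div_le_div_right s.2.le))] at h1
    refine Eq.trans ?_ h1
    refine List.countP_congr fun b _ => ?_
    simp only [Function.comp_apply, mem_dyadicBlock, decide_eq_true_eq]
    exact ⟨fun h' => h'.1, fun h' => ⟨h', h' ▸ h⟩⟩
  · rw [List.countP_eq_zero]
    intro b _
    simp only [Function.comp_apply, mem_dyadicBlock, decide_eq_true_eq]
    rintro ⟨rfl, h'⟩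
    exact h h'

theorem existsUnique_dyadicPartition {m : ℕ} {s t : Fin m} (hst : s ≠ t) :
    ∃! j : Fin (dyadicPartition m).length,
      s ∈ ((dyadicPartition m).get j).1 ∧ t ∈ ((dyadicPartition m).get j).2 := by
  classical
  refine List.existsUnique_get_of_countP_eq_one
    (p := fun X : Finset (Fin m) × Finset (Fin m) => s ∈ X.1 ∧ t ∈ X.2) ?_
  have hne : (t : ℕ) ≠ s := fun h => hst (Fin.ext h.symm)
  have hex : ∃ k, (t : ℕ) / 2 ^ k = s / 2 ^ k := by
    refine ⟨m, ?_⟩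
    rw [Nat.div_eq_of_lt (t.2.trans Nat.lt_two_pow_self),
      Nat.div_eq_of_lt (s.2.trans Nat.lt_two_pow_self)]
  have hclog : (t : ℕ) / 2 ^ Nat.clog 2 m = s / 2 ^ Nat.clog 2 m := by
    rw [Nat.div_eq_of_lt (t.2.trans_le (Nat.le_pow_clog (by norm_num) _)),
      Nat.div_eq_of_lt (s.2.trans_le (Nat.le_pow_clog (by norm_num) _))]
  -- The relevant scale is the one just before the first merging of `s` and `t`. Merging is
  -- permanent, and at scale `clog` only one block is left.
  obtain ⟨k, hk⟩ : ∃ k, Nat.find hex = k + 1 := Nat.exists_eq_succ_of_ne_zero fun h0 => by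
    have := Nat.find_spec hex
    rw [h0] at this
    simp at this
    exact hne this
  have hk1 : (t : ℕ) / 2 ^ (k + 1) = s / 2 ^ (k + 1) := hk ▸ Nat.find_spec hex
  have hk0 : (t : ℕ) / 2 ^ k ≠ s / 2 ^ k := Nat.find_min hex (by omega)
  have hkc : k < Nat.clog 2 m := by
    by_contra! h
    exact hk0 (div_pow_eq_of_le hclog h)
  rw [dyadicPartition, List.countP_flatMap]
  have : (List.countP (fun X : Finset (Fin m) × Finset (Fin m) => decide (s ∈ X.1 ∧ t ∈ X.2)) ∘
      fun k => dyadicPieces m (2 ^ k)) = fun l => if k = l then 1 else 0 := by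
    ext l
    simp only [Function.comp_apply]
    rw [countP_dyadicPieces_cell]
    refine if_congr (eq_sibling_div_iff.trans ⟨fun h => ?_, fun h => h ▸ ⟨hk0, hk1⟩⟩) rfl rfl
    by_contra hkl
    rcases Nat.lt_or_gt_of_ne hkl with h' | h'
    · exact h.1 (div_pow_eq_of_le hk1 h')
    · exact hk0 (div_pow_eq_of_le h.2 h')
  rw [this, List.sum_map_range_ite, if_pos hkc]

/-- The rows of a piece all come before or all come after its columns. -/
theorem separated_of_mem_dyadicPartition {m : ℕ} {X : Finset (Fin m) × Finset (Fin m)}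
    (hX : X ∈ dyadicPartition m) :
    (∀ s ∈ X.1, ∀ t ∈ X.2, s < t) ∨ ∀ s ∈ X.1, ∀ t ∈ X.2, t < s := by
  simp only [dyadicPartition, dyadicPieces, List.mem_flatMap, List.mem_map] at hX
  obtain ⟨k, -, b, -, rfl⟩ := hX
  simp only [mem_dyadicBlock]
  have key : ∀ {x y : Fin m}, (x : ℕ) / 2 ^ k < y / 2 ^ k → x < y := fun h =>
    Fin.lt_def.2 (lt_of_not_ge fun hge => h.not_ge (Nat.div_le_div_right hge))
  rcases Nat.lt_or_gt_of_ne (sibling_eq_iff.1 (rfl : sibling b = sibling b)).1 with h | h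
  · exact Or.inr fun s hs t ht => key (by rwa [hs, ht])
  · exact Or.inl fun s hs t ht => key (by rwa [hs, ht])

/-! ## Reasoning about programs -/

namespace RAM

/-- Started in `σ`, the program halts within `T` steps in a state that satisfies `Q`. -/
def Ends (W : ℕ) (p : Prog) (σ : Store) (T : ℕ) (Q : Store → Prop) : Prop :=
  ∃ t σ', t ≤ T ∧ Runs W p σ t σ' ∧ Q σ'

section Rules

variable {W T T₁ : ℕ} {p q : Prog} {σ : Store} {Q Q' : Store → Prop}

theorem Ends.mono (h : Ends W p σ T₁ Q') (hT : T₁ ≤ T) (hQ : ∀ σ', Q' σ' → Q σ') :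
    Ends W p σ T Q := by
  obtain ⟨t, σ', ht, hr, hq⟩ := h
  exact ⟨t, σ', ht.trans hT, hr, hQ _ hq⟩

theorem Ends.skip (hQ : Q σ) : Ends W .skip σ T Q := ⟨0, σ, Nat.zero_le _, .skip σ, hQ⟩

theorem Ends.const {r n : ℕ} (hn : n ≤ W) (hT : 1 ≤ T) (hQ : Q (σ.setReg r n)) :
    Ends W (.const r n) σ T Q := ⟨1, _, hT, .const σ r n hn, hQ⟩

theorem Ends.arith {o : Op} {r x y : ℕ} (n : ℕ) (hv : o.eval (σ.reg x) (σ.reg y) = n)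
    (hn : n ≤ W) (hT : 1 ≤ T) (hQ : Q (σ.setReg r n)) : Ends W (.arith o r x y) σ T Q := by
  subst hv
  exact ⟨1, _, hT, .arith σ o r x y hn, hQ⟩

theorem Ends.load {r a x : ℕ} (n : ℕ) (hv : σ.arr a (σ.reg x) = n) (hT : 1 ≤ T)
    (hQ : Q (σ.setReg r n)) : Ends W (.load r a x) σ T Q := by
  subst hv
  exact ⟨1, _, hT, .load σ r a x, hQ⟩

theorem Ends.store {a x y : ℕ} (i v : ℕ) (hi : σ.reg x = i) (hv : σ.reg y = v) (hT : 1 ≤ T)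
    (hQ : Q (σ.setArr a i v)) : Ends W (.store a x y) σ T Q := by
  subst hi hv
  exact ⟨1, _, hT, .store σ a x y, hQ⟩

/-- The rest of the program becomes the postcondition, with the remaining time; straight-line code
is verified by nesting. -/
theorem Ends.seq (hT : T₁ ≤ T) (h : Ends W p σ T₁ fun σ' => Ends W q σ' (T - T₁) Q) :
    Ends W (.seq p q) σ T Q := by
  obtain ⟨t, σ', ht, hr, t', σ'', ht', hr', hq⟩ := h
  exact ⟨t + t', σ'', by omega, .seq hr hr', hq⟩

theorem Ends.cond {x y : ℕ} (hT : 1 ≤ T) (h₁ : σ.reg x < σ.reg y → Ends W p σ (T - 1) Q)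
    (h₂ : ¬ σ.reg x < σ.reg y → Ends W q σ (T - 1) Q) : Ends W (.cond x y p q) σ T Q := by
  by_cases h : σ.reg x < σ.reg y
  · obtain ⟨t, σ', ht, hr, hq⟩ := h₁ h
    exact ⟨t + 1, σ', by omega, .cond_true h hr, hq⟩
  · obtain ⟨t, σ', ht, hr, hq⟩ := h₂ h
    exact ⟨t + 1, σ', by omega, .cond_false h hr, hq⟩

/-- A loop with the invariant `I k` after `k` of `N` rounds and the potential `f`. -/
theorem Ends.loop {x y N : ℕ} (I : ℕ → Store → Prop) (f c : ℕ → ℕ)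
    (hc : ∀ k < N, f k + c k + 1 ≤ f (k + 1))
    (hlt : ∀ k < N, ∀ σ, I k σ → σ.reg x < σ.reg y) (hge : ∀ σ, I N σ → ¬ σ.reg x < σ.reg y)
    (hbody : ∀ k < N, ∀ σ, I k σ → Ends W p σ (c k) (I (k + 1)))
    (hT : f N + 1 ≤ T + f 0) (h0 : I 0 σ) : Ends W (.loop x y p) σ T (I N) := by
  -- Induction on the number `d` of remaining rounds; the extra `1` pays for the final failing test.
  have key : ∀ d k σ, k + d = N → I k σ →
      ∃ t σ', t + f k ≤ f N + 1 ∧ Runs W (.loop x y p) σ t σ' ∧ I N σ' := by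
    intro d
    induction d with
    | zero =>
      intro k σ hk hI
      rw [Nat.add_zero] at hk
      subst hk
      exact ⟨1, σ, by omega, .loop_false (hge σ hI), hI⟩
    | succ d ih =>
      intro k σ hk hI
      obtain ⟨t, σ', ht, hr, hI'⟩ := hbody k (by omega) σ hI
      obtain ⟨t', σ'', ht', hr', hI''⟩ := ih (k + 1) σ' (by omega) hI'
      have := hc k (by omega)
      exact ⟨t + t' + 1, σ'', by omega, .loop_true (hlt k (by omega) σ hI) hr hr', hI''⟩
  obtain ⟨t, σ', ht, hr, hI⟩ := key N 0 σ (by omega) h0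
  exact ⟨t, σ', by omega, hr, hI⟩

end Rules

namespace Store

variable (σ : Store)

@[simp] theorem setReg_reg (r v r' : ℕ) :
    (σ.setReg r v).reg r' = if r' = r then v else σ.reg r' := by
  simp [setReg, Function.update_apply]

@[simp] theorem setReg_arr (r v a : ℕ) : (σ.setReg r v).arr a = σ.arr a := rfl

@[simp] theorem setArr_reg (a i v r : ℕ) : (σ.setArr a i v).reg r = σ.reg r := rfl

theorem setArr_arr_of_ne {a a' : ℕ} (h : a' ≠ a) (i v : ℕ) :
    (σ.setArr a i v).arr a' = σ.arr a' := by
  simp [setArr, h]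

variable {σ}

theorem Holds.congr {σ' : Store} {a : ℕ} {L : List ℕ} (h : σ.Holds a L)
    (ha : σ'.arr a = σ.arr a) : σ'.Holds a L := fun i hi => by rw [ha, h i hi]

theorem Holds.setArr {a : ℕ} {L : List ℕ} (h : σ.Holds a L) {i : ℕ} (hi : i = L.length) (v : ℕ) :
    (σ.setArr a i v).Holds a (L ++ [v]) := by
  intro j hj
  subst hi
  simp only [Store.setArr, Function.update_self, Function.update_apply]
  split_ifs with h'
  · subst h'
    simp
  · simp only [List.length_append, List.length_singleton] at hj
    rw [List.getElem_append_left (by omega), h]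

theorem Holds.getElem_append {a : ℕ} {L L' : List ℕ} (h : σ.Holds a (L ++ L')) {i : ℕ}
    (hi : i < L'.length) : σ.arr a (L.length + i) = L'[i] := by
  rw [h _ (by simp [hi])]
  simp

/-- `σ'` differs from `σ` only in the listed registers and arrays. -/
def SameExcept (R As : List ℕ) (σ σ' : Store) : Prop :=
  (∀ r ∉ R, σ'.reg r = σ.reg r) ∧ ∀ a ∉ As, σ'.arr a = σ.arr a

end Store

/-! ## The program -/

/-- Append to the array `a` with the pointer `p` the indices of the block whose number is in the
register `v`; the block length is in the register `2`. -/
def scan (a p v : ℕ) : Prog :=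
  .seq (.const 5 0) <|
  .loop 5 0 <|
  .seq (.arith .div 6 5 2) <|
  -- Only `<` can be tested, so equality is the failure of both strict comparisons.
  .seq (.cond 6 v .skip (.cond v 6 .skip (.seq (.store a p 5) (.arith .add p p 7))))
    (.arith .add 5 5 7)

/-- The elements of a block, as a list of numbers. -/
def blockList (m w b : ℕ) : List ℕ := (List.range m).filter fun x => x / w = b

theorem blockList_succ (m w b : ℕ) :
    blockList (m + 1) w b = blockList m w b ++ if m / w = b then [m] else [] := by
  simp only [blockList, List.range_succ, List.filter_append, List.filter_singleton]
  split_ifs <;> simp_all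

theorem length_blockList_le (m w b : ℕ) : (blockList m w b).length ≤ m :=
  (List.length_filter_le _ _).trans (by simp)

theorem Ends.scan {W m w b a p v : ℕ} {L : List ℕ} {σ : Store} (h0 : σ.reg 0 = m)
    (h2 : σ.reg 2 = w) (h7 : σ.reg 7 = 1) (hv : σ.reg v = b) (hL : σ.Holds a L)
    (hp : σ.reg p = L.length) (hpr : p ∉ [0, 2, 5, 6, 7]) (hvr : v ∉ [5, 6, p])
    (hW : L.length + m ≤ W) :
    Ends W (scan a p v) σ (7 * m + 2) fun σ' => σ'.Holds a (L ++ blockList m w b) ∧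
      σ'.reg p = (L ++ blockList m w b).length ∧ σ.SameExcept [5, 6, p] [a] σ' := by
  simp only [List.mem_cons, List.not_mem_nil, or_false, not_or] at hpr hvr
  obtain ⟨p0, p2, p5, p6, p7⟩ := hpr
  obtain ⟨v5, v6, vp⟩ := hvr
  refine Ends.seq (T₁ := 1) (by omega) (Ends.const (Nat.zero_le _) le_rfl ?_)
  -- Seven steps per round: the loop test, the quotient, at most four for comparing and appending,
  -- and the increment.
  refine (Ends.loop (N := m) (fun k σ' => σ'.reg 5 = k ∧ σ'.Holds a (L ++ blockList k w b) ∧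
      σ'.reg p = (L ++ blockList k w b).length ∧ σ.SameExcept [5, 6, p] [a] σ')
    (fun k => 7 * k) (fun _ => 6) (fun k _ => by omega) ?_ ?_ ?_ (by omega) ?_).mono le_rfl
    (fun σ' h => h.2)
  · rintro k hk τ ⟨h5, -, -, hs, -⟩
    rw [h5, hs 0 (by simp [Ne.symm p0]), h0]
    exact hk
  · rintro τ ⟨h5, -, -, hs, -⟩
    rw [h5, hs 0 (by simp [Ne.symm p0]), h0]
    exact lt_irrefl _
  · rintro k hk τ ⟨h5, hH, hpl, hs, hsa⟩
    have t2 : τ.reg 2 = w := by rw [hs 2 (by simp [Ne.symm p2]), h2]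
    have t7 : τ.reg 7 = 1 := by rw [hs 7 (by simp [Ne.symm p7]), h7]
    have tv : τ.reg v = b := by rw [hs v (by simp [v5, v6, vp]), hv]
    have hlen := length_blockList_le k w b
    refine Ends.seq (T₁ := 1) (by omega) (Ends.arith (k / w) (by simp [Op.eval, h5, t2])
      ((Nat.div_le_self _ _).trans (by omega)) le_rfl ?_)
    refine Ends.seq (T₁ := 4) (by omega) (Ends.mono (T₁ := 4) (Q' := fun τ' => τ'.reg 5 = k ∧
      τ'.Holds a (L ++ blockList (k + 1) w b) ∧ τ'.reg p = (L ++ blockList (k + 1) w b).length ∧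
      σ.SameExcept [5, 6, p] [a] τ') ?_ le_rfl ?_)
    · have hskip : k / w ≠ b → Ends W .skip (τ.setReg 6 (k / w)) 2
          (fun τ' => τ'.reg 5 = k ∧ τ'.Holds a (L ++ blockList (k + 1) w b) ∧
            τ'.reg p = (L ++ blockList (k + 1) w b).length ∧ σ.SameExcept [5, 6, p] [a] τ') := by
        intro hne
        rw [blockList_succ, if_neg hne, List.append_nil]
        refine Ends.skip ⟨by simpa using h5, hH, by simpa [p6] using hpl, fun r hr => ?_, hsa⟩
        have h6 : r ≠ 6 := fun h => by simp [h] at hr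
        simpa [h6] using hs r hr
      refine Ends.cond (by omega) (fun hlt => ?_) (fun hlt => Ends.cond (by omega) (fun hgt => ?_)
        (fun hgt => ?_))
      · simp only [Store.setReg_reg, v6, if_true, if_false, tv] at hlt
        exact (hskip hlt.ne).mono (by omega) fun _ h => h
      · simp only [Store.setReg_reg, v6, if_true, if_false, tv] at hgt
        exact (hskip hgt.ne').mono (by omega) fun _ h => h
      · simp only [Store.setReg_reg, v6, if_true, if_false, tv] at hgt hlt
        have heq : k / w = b := by omega
        rw [blockList_succ, if_pos heq, ← List.append_assoc]
        refine Ends.seq (T₁ := 1) (by omega) (Ends.store (L ++ blockList k w b).length k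
          (by simpa [p6] using hpl) (by simpa using h5) le_rfl (Ends.arith
          ((L ++ blockList k w b).length + 1) (by simp [Op.eval, p6, hpl, t7]) ?_ (by omega) ?_))
        · rw [List.length_append]
          omega
        · refine ⟨by simpa [Ne.symm p5] using h5, ?_, by simp [add_assoc], fun r hr => ?_,
            fun a' ha' => ?_⟩
          · exact (Store.Holds.setArr (σ := τ) hH rfl k).congr rfl
          · have h6 : r ≠ 6 := fun h => by simp [h] at hr
            have hp' : r ≠ p := fun h => by simp [h] at hr
            simpa [h6, hp'] using hs r hr
          · rw [Store.setReg_arr, Store.setArr_arr_of_ne _ (by simpa using ha')]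
            exact hsa a' ha'
    · rintro τ' ⟨g5, gH, gp, gs, gsa⟩
      have g7 : τ'.reg 7 = 1 := by rw [gs 7 (by simp [Ne.symm p7]), h7]
      refine Ends.arith (k + 1) (by simp [Op.eval, g5, g7]) (by omega) (by omega)
        ⟨by simp, gH.congr rfl, by simpa [p5] using gp, fun r hr => ?_, gsa⟩
      have h5' : r ≠ 5 := fun h => by simp [h] at hr
      simpa [h5'] using gs r hr
  · refine ⟨by simp, ?_, ?_, fun r hr => ?_, fun _ _ => rfl⟩
    · simpa [blockList] using hL.congr (σ' := σ.setReg 5 0) rfl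
    · simpa [blockList, p5] using hp
    · have h5' : r ≠ 5 := fun h => by simp [h] at hr
      simp [h5']

/-- Append to the array `6` the entries of the row whose offset is in the register `15`, in the
columns in the array `5` from the pointer `14` to the pointer `9`. -/
def emitRow : Prog :=
  .loop 14 9 <|
  .seq (.load 16 5 14) <|
  .seq (.arith .add 16 15 16) <|
  .seq (.load 16 1 16) <|
  .seq (.store 6 10 16) <|
  .seq (.arith .add 10 10 7) (.arith .add 14 14 7)

/-- Append to the array `6` the entries of the rows in the array `4` from the pointer `12` to the
pointer `8` and the columns in the array `5` from the pointer `13` to the pointer `9`. -/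
def emit : Prog :=
  .loop 12 8 <|
  .seq (.load 15 4 12) <|
  .seq (.arith .mul 15 15 0) <|
  .seq (.arith .add 14 13 18) <|
  .seq emitRow (.arith .add 12 12 7)

/-- The array `1` is the matrix `A`, row by row. -/
def HoldsMatrix {m : ℕ} (A : Matrix (Fin m) (Fin m) Bool) (σ : Store) : Prop :=
  ∀ s t : Fin m, σ.arr 1 (s * m + t) = (A s t).toNat

theorem cell_lt {m : ℕ} (s t : Fin m) : (s : ℕ) * m + t < m * m := by
  have : ((s : ℕ) + 1) * m ≤ m * m := Nat.mul_le_mul_right _ s.2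
  have := t.2
  linarith

theorem Ends.emitRow {W m : ℕ} {A : Matrix (Fin m) (Fin m) Bool} {σ : Store} {s : Fin m}
    {L₅ L₆ : List ℕ} {T : List (Fin m)} (h7 : σ.reg 7 = 1) (h15 : σ.reg 15 = s * m)
    (h14 : σ.reg 14 = L₅.length) (h9 : σ.reg 9 = (L₅ ++ T.map Fin.val).length)
    (h10 : σ.reg 10 = L₆.length) (hA : HoldsMatrix A σ) (hL₅ : σ.Holds 5 (L₅ ++ T.map Fin.val))
    (hL₆ : σ.Holds 6 L₆) (hW : m * m ≤ W) (hW₅ : (L₅ ++ T.map Fin.val).length ≤ W)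
    (hW₆ : L₆.length + T.length ≤ W) :
    Ends W emitRow σ (7 * T.length + 1) fun σ' =>
      σ'.Holds 6 (L₆ ++ T.map fun t => (A s t).toNat) ∧
      σ'.reg 10 = (L₆ ++ T.map fun t => (A s t).toNat).length ∧
      σ.SameExcept [10, 14, 16] [6] σ' := by
  simp only [List.length_append, List.length_map] at h9 hW₅
  refine (Ends.loop (N := T.length) (fun k σ' => σ'.reg 14 = L₅.length + k ∧
      σ'.Holds 6 (L₆ ++ (T.take k).map fun t => (A s t).toNat) ∧
      σ'.reg 10 = L₆.length + k ∧ σ.SameExcept [10, 14, 16] [6] σ')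
    (fun k => 7 * k) (fun _ => 6) (fun k _ => by omega) ?_ ?_ ?_ (by omega) ?_).mono le_rfl
    (fun σ' h => ?_)
  · rintro k hk τ ⟨h, -, -, hs, -⟩
    rw [h, hs 9 (by simp), h9]
    omega
  · rintro τ ⟨h, -, -, hs, -⟩
    rw [h, hs 9 (by simp), h9]
    omega
  · rintro k hk τ ⟨t14, t6, t10, hs, hsa⟩
    have t7 : τ.reg 7 = 1 := by rw [hs 7 (by simp), h7]
    have t15 : τ.reg 15 = s * m := by rw [hs 15 (by simp), h15]
    have t5 : τ.arr 5 (L₅.length + k) = T[k] := by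
      rw [hsa 5 (by simp), hL₅.getElem_append (by simpa using hk)]
      simp
    have t1 : τ.arr 1 (s * m + T[k]) = (A s T[k]).toNat := by
      rw [hsa 1 (by simp), hA]
    refine Ends.seq (T₁ := 1) (by omega) (Ends.load T[k] (by rw [t14, t5]) le_rfl ?_)
    refine Ends.seq (T₁ := 1) (by omega) (Ends.arith (s * m + T[k]) (by simp [Op.eval, t15])
      ((cell_lt s T[k]).le.trans hW) le_rfl ?_)
    refine Ends.seq (T₁ := 1) (by omega) (Ends.load (A s T[k]).toNat (by simpa using t1) le_rfl ?_)
    refine Ends.seq (T₁ := 1) (by omega) (Ends.store (L₆.length + k) (A s T[k]).toNat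
      (by simpa using t10) (by simp) le_rfl ?_)
    refine Ends.seq (T₁ := 1) (by omega) (Ends.arith (L₆.length + (k + 1))
      (by simp [Op.eval, t10, t7, add_assoc]) (by omega) le_rfl ?_)
    refine Ends.arith (L₅.length + (k + 1)) (by simp [Op.eval, t14, t7, add_assoc]) (by omega)
      (by omega) ⟨by simp, ?_, by simp, fun r hr => ?_, fun a ha => ?_⟩
    · rw [List.take_succ_eq_append_getElem hk, List.map_append, ← List.append_assoc]
      exact (Store.Holds.setArr (σ := τ) t6 (by simp [Nat.min_eq_left hk.le]) _).congr rfl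
    · simp only [List.mem_cons, List.not_mem_nil, or_false, not_or] at hr
      simp only [Store.setReg_reg, Store.setArr_reg, hr, if_false]
      exact hs r (by simp [hr])
    · rw [Store.setReg_arr, Store.setReg_arr, Store.setArr_arr_of_ne _ (by simpa using ha)]
      exact hsa a ha
  · exact ⟨by simpa using h14, by simpa using hL₆, by simpa using h10, fun _ _ => rfl,
      fun _ _ => rfl⟩
  · rw [List.take_length] at h
    exact ⟨h.2.1, by simpa using h.2.2.1, h.2.2.2⟩

/-- Besides seven steps per entry, each row costs six: its loop test, three preparations, the final
test of the inner loop and an increment. -/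
theorem Ends.emit {W m : ℕ} {A : Matrix (Fin m) (Fin m) Bool} {σ : Store}
    {L₄ L₅ L₆ : List ℕ} {S T : List (Fin m)} (h0 : σ.reg 0 = m) (h7 : σ.reg 7 = 1)
    (h18 : σ.reg 18 = 0) (h12 : σ.reg 12 = L₄.length)
    (h8 : σ.reg 8 = (L₄ ++ S.map Fin.val).length) (h13 : σ.reg 13 = L₅.length)
    (h9 : σ.reg 9 = (L₅ ++ T.map Fin.val).length) (h10 : σ.reg 10 = L₆.length)
    (hA : HoldsMatrix A σ) (hL₄ : σ.Holds 4 (L₄ ++ S.map Fin.val))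
    (hL₅ : σ.Holds 5 (L₅ ++ T.map Fin.val)) (hL₆ : σ.Holds 6 L₆) (hW : m * m ≤ W)
    (hW₄ : (L₄ ++ S.map Fin.val).length ≤ W) (hW₅ : (L₅ ++ T.map Fin.val).length ≤ W)
    (hW₆ : L₆.length + S.length * T.length ≤ W) :
    Ends W emit σ (7 * (S.length * T.length) + 6 * S.length + 1) fun σ' =>
      σ'.Holds 6 (L₆ ++ entries A S T) ∧ σ'.reg 10 = (L₆ ++ entries A S T).length ∧
      σ.SameExcept [10, 12, 14, 15, 16] [6] σ' := by
  simp only [List.length_append, List.length_map] at h8 hW₄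
  have hlen : ∀ k ≤ S.length, (entries A (S.take k) T).length = k * T.length := fun k hk => by
    simp [entries, List.length_flatMap, Nat.min_eq_left hk]
  refine (Ends.loop (N := S.length) (fun k σ' => σ'.reg 12 = L₄.length + k ∧
      σ'.Holds 6 (L₆ ++ entries A (S.take k) T) ∧
      σ'.reg 10 = (L₆ ++ entries A (S.take k) T).length ∧
      σ.SameExcept [10, 12, 14, 15, 16] [6] σ')
    (fun k => 7 * (k * T.length) + 6 * k) (fun _ => 7 * T.length + 5)
    (fun k _ => by rw [add_mul, one_mul]; omega) ?_ ?_ ?_ (by omega) ?_).mono le_rfl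
    (fun σ' h => ?_)
  · rintro k hk τ ⟨h, -, -, hs, -⟩
    rw [h, hs 8 (by simp), h8]
    omega
  · rintro τ ⟨h, -, -, hs, -⟩
    rw [h, hs 8 (by simp), h8]
    omega
  · rintro k hk τ ⟨t12, t6, t10, hs, hsa⟩
    have t0 : τ.reg 0 = m := by rw [hs 0 (by simp), h0]
    have t7 : τ.reg 7 = 1 := by rw [hs 7 (by simp), h7]
    have t9 := hs 9 (by simp)
    have t13 : τ.reg 13 = L₅.length := by rw [hs 13 (by simp), h13]
    have t18 : τ.reg 18 = 0 := by rw [hs 18 (by simp), h18]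
    have t4 : τ.arr 4 (L₄.length + k) = S[k] := by
      rw [hsa 4 (by simp), hL₄.getElem_append (by simpa using hk)]
      simp
    have hk1 : (k + 1) * T.length ≤ S.length * T.length := Nat.mul_le_mul_right _ hk
    rw [Nat.succ_mul] at hk1
    refine Ends.seq (T₁ := 1) (by omega) (Ends.load S[k] (by rw [t12, t4]) le_rfl ?_)
    refine Ends.seq (T₁ := 1) (by omega) (Ends.arith (S[k] * m) (by simp [Op.eval, t0])
      ((Nat.mul_le_mul_right _ S[k].2.le).trans hW) le_rfl ?_)
    refine Ends.seq (T₁ := 1) (by omega) (Ends.arith L₅.length (by simp [Op.eval, t13, t18])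
      (by simp at hW₅; omega) le_rfl ?_)
    refine Ends.seq (T₁ := 7 * T.length + 1) (by omega) (Ends.mono (Ends.emitRow (W := W) (A := A)
      (s := S[k]) (L₅ := L₅) (L₆ := L₆ ++ entries A (S.take k) T) (T := T) ?_ ?_ ?_ ?_ ?_ ?_ ?_ ?_
      hW hW₅ ?_) le_rfl ?_)
    · simpa using t7
    · simp
    · simp
    · simpa [t9] using h9
    · simpa using t10
    · intro s t
      simpa [hsa 1 (by simp)] using hA s t
    · exact hL₅.congr (by simpa using hsa 5 (by simp))
    · exact t6.congr rfl
    · rw [List.length_append, hlen k hk.le]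
      omega
    · rintro τ' ⟨g6, g10, gs, gsa⟩
      have g12 : τ'.reg 12 = L₄.length + k := by
        rw [gs 12 (by simp)]
        simpa using t12
      have g7 : τ'.reg 7 = 1 := by
        rw [gs 7 (by simp)]
        simpa using t7
      have he : L₆ ++ entries A (S.take (k + 1)) T =
          L₆ ++ entries A (S.take k) T ++ T.map fun t => (A S[k] t).toNat := by
        rw [List.take_succ_eq_append_getElem hk]
        simp only [entries, List.flatMap_append, List.flatMap_singleton, List.append_assoc]
      refine Ends.arith (L₄.length + (k + 1)) (by simp [Op.eval, g12, g7, add_assoc]) (by omega)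
        (by omega) ⟨by simp, ?_, ?_, fun r hr => ?_, fun a ha => ?_⟩
      · rw [he]
        exact g6.congr rfl
      · rw [he]
        simpa using g10
      · simp only [List.mem_cons, List.not_mem_nil, or_false, not_or] at hr
        rw [Store.setReg_reg, if_neg hr.2.1, gs r (by simp [hr])]
        simp only [Store.setReg_reg, hr, if_false]
        exact hs r (by simp [hr])
      · rw [Store.setReg_arr, gsa a ha]
        exact hsa a ha
  · exact ⟨by simpa using h12, by simpa [entries] using hL₆, by simpa [entries] using h10,
      fun _ _ => rfl, fun _ _ => rfl⟩
  · rw [List.take_length] at h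
    exact h.2

end RAM

/-! ### Total size of the dyadic pieces -/

theorem card_dyadicBlock_le (m w b : ℕ) (hw : 0 < w) : (dyadicBlock m w b).card ≤ w := by
  have : (dyadicBlock m w b).card ≤ (Finset.Ico (b * w) ((b + 1) * w)).card := by
    refine Finset.card_le_card_of_injOn Fin.val (fun x hx => ?_) Fin.val_injective.injOn
    rw [Finset.mem_coe, mem_dyadicBlock] at hx
    rw [Finset.mem_coe, Finset.mem_Ico, ← Nat.le_div_iff_mul_le hw, ← Nat.div_lt_iff_lt_mul hw]
    omega
  rwa [Nat.card_Ico, add_mul, one_mul, Nat.add_sub_cancel_left] at this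

/-- A bound, up to a constant factor, for the effort of writing down a submatrix. -/
def pieceWeight {m : ℕ} (X : Finset (Fin m) × Finset (Fin m)) : ℕ :=
  m + 1 + X.1.card * X.2.card

/-- The sum of the weights of the pieces. -/
def totalWeight {m : ℕ} (D : List (Finset (Fin m) × Finset (Fin m))) : ℕ :=
  (D.map pieceWeight).sum

section Weight

variable {m : ℕ}

theorem totalWeight_append (D D' : List (Finset (Fin m) × Finset (Fin m))) :
    totalWeight (D ++ D') = totalWeight D + totalWeight D' := by
  simp [totalWeight]

theorem totalWeight_singleton (X : Finset (Fin m) × Finset (Fin m)) :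
    totalWeight [X] = pieceWeight X := by
  simp [totalWeight]

theorem card_le_of_finset_fin (S : Finset (Fin m)) : S.card ≤ m := by
  simpa using S.card_le_univ

theorem length_le_totalWeight (D : List (Finset (Fin m) × Finset (Fin m))) :
    D.length ≤ totalWeight D := by
  induction D with
  | nil => simp
  | cons X D ih =>
    rw [← List.singleton_append, totalWeight_append, totalWeight_singleton, pieceWeight,
      List.length_append, List.length_singleton]
    omega

theorem length_flatMap_le_totalWeight {α : Type*} (D : List (Finset (Fin m) × Finset (Fin m)))
    (f : Finset (Fin m) × Finset (Fin m) → List α) (h : ∀ X, (f X).length ≤ pieceWeight X) :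
    (D.flatMap f).length ≤ totalWeight D := by
  induction D with
  | nil => simp
  | cons X D ih =>
    rw [← List.singleton_append, totalWeight_append, totalWeight_singleton, List.flatMap_append,
      List.length_append, List.flatMap_singleton]
    exact Nat.add_le_add (h X) ih

/-- There are `m / w + 1` pieces, each with at most `w * w` entries; `w ≤ m` absorbs the additional
piece. -/
theorem totalWeight_dyadicPieces_le {w : ℕ} (hw : 0 < w) (hwm : w ≤ m) :
    totalWeight (dyadicPieces m w) ≤ m / w * (m + 1) + (m + 1) + 2 * m * w := by
  have h1 : ∀ L : List ℕ, totalWeight (L.map fun b =>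
      (dyadicBlock m w b, dyadicBlock m w (sibling b))) ≤ L.length * (m + 1 + w * w) := by
    intro L
    induction L with
    | nil => simp [totalWeight]
    | cons b L ih =>
      rw [List.map_cons, ← List.singleton_append, totalWeight_append, totalWeight_singleton,
        List.length_cons, add_mul, one_mul, add_comm]
      refine Nat.add_le_add ih (Nat.add_le_add_left (Nat.mul_le_mul ?_ ?_) _) <;>
      exact card_dyadicBlock_le _ _ _ hw
  refine (h1 _).trans ?_
  rw [List.length_range]
  have h2 : m / w * w ≤ m := Nat.div_mul_le_self m w
  nlinarith [Nat.mul_le_mul_right w h2, Nat.mul_le_mul_right w hwm]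

theorem totalWeight_dyadicPartition_le (m : ℕ) :
    totalWeight (dyadicPartition m) ≤ 10 * m ^ 2 := by
  -- The summand `2 * m` on the left makes the geometric sum of the `2 * m * 2 ^ k` telescope in the
  -- induction.
  have key : ∀ n ≤ Nat.clog 2 m, totalWeight ((List.range n).flatMap fun k =>
      dyadicPieces m (2 ^ k)) + 2 * m ≤
        (∑ k ∈ Finset.range n, m / 2 ^ k) * (m + 1) + n * (m + 1) + 2 * m * 2 ^ n := by
    intro n
    induction n with
    | zero => simp [totalWeight]
    | succ n ih =>
      intro hn
      have h1 := ih (by omega)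
      have h2 := totalWeight_dyadicPieces_le (m := m) (w := 2 ^ n) (by positivity)
        (Nat.pow_lt_of_lt_clog (by omega)).le
      rw [List.range_succ, List.flatMap_append, List.flatMap_singleton, totalWeight_append,
        Finset.sum_range_succ, add_mul, add_mul, pow_succ]
      linarith
  rcases Nat.lt_or_ge m 2 with h | h
  · rw [dyadicPartition, Nat.clog_of_right_le_one (by omega)]
    simp [totalWeight]
  have h1 := key _ le_rfl
  have h2 := Nat.geom_sum_le le_rfl m (Nat.clog 2 m)
  have h3 : Nat.clog 2 m ≤ m := Nat.clog_le_of_le_pow Nat.lt_two_pow_self.le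
  have h4 : 2 ^ Nat.clog 2 m ≤ 2 * m := by
    have := (Nat.pow_pred_clog_lt_self (b := 2) (by norm_num) (show 1 < m by omega)).le
    have hpos : 0 < Nat.clog 2 m := Nat.clog_pos (by norm_num) h
    obtain ⟨n, hn⟩ := Nat.exists_eq_succ_of_ne_zero hpos.ne'
    rw [hn] at this ⊢
    rw [Nat.pred_succ] at this
    rw [pow_succ]
    omega
  simp only [Nat.add_one_sub_one, Nat.div_one] at h2
  rw [dyadicPartition]
  nlinarith [Nat.mul_le_mul_right (m + 1) h2, Nat.mul_le_mul_right (m + 1) h3,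
    Nat.mul_le_mul_left (2 * m) h4]

end Weight

/-! ### Writing the pieces, the scales and the whole partition -/

namespace RAM

theorem map_val_sort_dyadicBlock (m w b : ℕ) :
    (dyadicBlock m w b).sort.map Fin.val = blockList m w b := by
  unfold blockList
  refine List.Perm.eq_of_pairwise' (r := (· < ·)) ?_ ?_ ?_
  · rw [List.pairwise_map]
    exact (dyadicBlock m w b).sortedLT_sort.pairwise
  · exact List.pairwise_lt_range.filter _
  · rw [List.perm_ext_iff_of_nodup
      ((List.nodup_map_iff Fin.val_injective).2 (Finset.sort_nodup _ _))
      (List.nodup_range.filter _)]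
    intro x
    simp only [List.mem_map, Finset.mem_sort, mem_dyadicBlock, List.mem_filter, List.mem_range,
      decide_eq_true_eq]
    exact ⟨fun ⟨y, hy, hyx⟩ => hyx ▸ ⟨y.2, hy⟩, fun ⟨h1, h2⟩ => ⟨⟨x, h1⟩, h2, rfl⟩⟩

/-- Store in `s` the pointer `p` of the array `a`, append a block to `a`, and append the number of
its elements to the array `c`. -/
def listBlock (a p v c s : ℕ) : Prog :=
  .seq (.arith .add s p 18) <|
  .seq (scan a p v) <|
  .seq (.arith .sub 16 p s) (.store c 17 16)

theorem Ends.listBlock {W m w b a p v c s : ℕ} {L Lc : List ℕ} {σ : Store} (h0 : σ.reg 0 = m)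
    (h2 : σ.reg 2 = w) (h7 : σ.reg 7 = 1) (h18 : σ.reg 18 = 0) (hv : σ.reg v = b)
    (hL : σ.Holds a L) (hp : σ.reg p = L.length) (hLc : σ.Holds c Lc) (hc : σ.reg 17 = Lc.length)
    (hpr : p ∉ [0, 2, 5, 6, 7, 16, 17, 18]) (hvr : v ∉ [5, 6, 16, p, s])
    (hsr : s ∉ [0, 2, 5, 6, 7, 16, 17, 18, p]) (hac : a ≠ c) (hW : L.length + m ≤ W) :
    Ends W (listBlock a p v c s) σ (7 * m + 5) fun σ' => σ'.Holds a (L ++ blockList m w b) ∧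
      σ'.reg p = (L ++ blockList m w b).length ∧ σ'.reg s = L.length ∧
      σ'.Holds c (Lc ++ [(blockList m w b).length]) ∧ σ.SameExcept [5, 6, 16, p, s] [a, c] σ' := by
  simp only [List.mem_cons, List.not_mem_nil, or_false, not_or] at hpr hvr hsr
  obtain ⟨p0, p2, p5, p6, p7, p16, p17, p18⟩ := hpr
  obtain ⟨v5, v6, v16, vp, vs⟩ := hvr
  obtain ⟨s0, s2, s5, s6, s7, s16, s17, s18, sp⟩ := hsr
  have hlen := length_blockList_le m w b
  refine Ends.seq (T₁ := 1) (by omega) (Ends.arith L.length (by simp [Op.eval, hp, h18])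
    (by omega) le_rfl ?_)
  refine Ends.seq (T₁ := 7 * m + 2) (by omega) (Ends.mono (Ends.scan (m := m) (w := w) (b := b)
    (L := L) (by simp [Ne.symm s0, h0]) (by simp [Ne.symm s2, h2]) (by simp [Ne.symm s7, h7])
    (by simp [vs, hv]) (hL.congr rfl) (by simp [Ne.symm sp, hp]) (by simp [*]) (by simp [*]) hW)
    le_rfl ?_)
  rintro τ ⟨tH, tp, ts, tsa⟩
  have ts' : τ.reg s = L.length := by
    rw [ts s (by simp [*])]
    simp
  have t17 : τ.reg 17 = Lc.length := by
    rw [ts 17 (by simp [Ne.symm p17])]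
    simp [Ne.symm s17, hc]
  refine Ends.seq (T₁ := 1) (by omega) (Ends.arith (blockList m w b).length
    (by simp [Op.eval, tp, ts']) (by omega) le_rfl ?_)
  refine Ends.store Lc.length (blockList m w b).length (by simp [t17]) (by simp) (by omega)
    ⟨tH.congr (Store.setArr_arr_of_ne _ hac _ _), by simpa [p16] using tp,
      by simpa [s16] using ts', Store.Holds.setArr
        ((hLc.congr (tsa c (by simpa using hac.symm))).congr rfl) rfl _, fun r hr => ?_,
      fun a' ha' => ?_⟩
  · simp only [List.mem_cons, List.not_mem_nil, or_false, not_or] at hr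
    simp only [Store.setArr_reg, Store.setReg_reg, hr, if_false]
    rw [ts r (by simp [hr])]
    simp [hr]
  · simp only [List.mem_cons, List.not_mem_nil, or_false, not_or] at ha'
    rw [Store.setArr_arr_of_ne _ ha'.2]
    exact tsa a' (by simpa using ha'.1)

/-- Put the sibling of the number in the register `3` into the register `4`. -/
def findSibling : Prog :=
  -- Two doublings produce `4 * (b / 2)`; adding `1` before subtracting `b` keeps the truncated
  -- subtraction exact.
  .seq (.arith .div 4 3 19) <|
  .seq (.arith .add 4 4 4) <|
  .seq (.arith .add 4 4 4) <|
  .seq (.arith .add 4 4 7) (.arith .sub 4 4 3)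

theorem Ends.findSibling {W b : ℕ} {σ : Store} (h3 : σ.reg 3 = b) (h7 : σ.reg 7 = 1)
    (h19 : σ.reg 19 = 2) (hW : 2 * b + 1 ≤ W) :
    Ends W findSibling σ 5 fun σ' => σ' = ((((σ.setReg 4 (b / 2)).setReg 4
      (2 * (b / 2))).setReg 4 (4 * (b / 2))).setReg 4 (4 * (b / 2) + 1)).setReg 4 (sibling b) := by
  refine Ends.seq (T₁ := 1) (by omega) (Ends.arith (b / 2) (by simp [Op.eval, h3, h19])
    (by omega) le_rfl ?_)
  refine Ends.seq (T₁ := 1) (by omega) (Ends.arith (2 * (b / 2))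
    (by simp [Op.eval]; omega) (by omega) le_rfl ?_)
  refine Ends.seq (T₁ := 1) (by omega) (Ends.arith (4 * (b / 2))
    (by simp [Op.eval]; omega) (by omega) le_rfl ?_)
  refine Ends.seq (T₁ := 1) (by omega) (Ends.arith (4 * (b / 2) + 1)
    (by simp [Op.eval, h7]) (by omega) le_rfl ?_)
  exact Ends.arith (sibling b) (by simp [Op.eval, h3, sibling])
    (by unfold sibling; omega) (by omega) rfl

/-- The pieces `D` have been written. -/
structure Written {m : ℕ} (A : Matrix (Fin m) (Fin m) Bool)
    (D : List (Finset (Fin m) × Finset (Fin m))) (σ : Store) : Prop where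
  reg_zero : σ.reg 0 = m
  -- Registers `7`, `18`, `19` hold the constants `1`, `0`, `2`; `17` counts the pieces; `8`, `9`,
  -- `10` point to the ends of the arrays `4`, `5`, `6`. The loop variables `2`, `3`, `11` remain
  -- unconstrained.
  reg_seven : σ.reg 7 = 1
  reg_eighteen : σ.reg 18 = 0
  reg_nineteen : σ.reg 19 = 2
  reg_seventeen : σ.reg 17 = D.length
  reg_eight : σ.reg 8 = (D.flatMap fun X => X.1.sort.map Fin.val).length
  reg_nine : σ.reg 9 = (D.flatMap fun X => X.2.sort.map Fin.val).length
  reg_ten : σ.reg 10 = (D.flatMap fun X => entries A X.1.sort X.2.sort).length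
  matrix : HoldsMatrix A σ
  holds_two : σ.Holds 2 (D.map fun X => X.1.card)
  holds_three : σ.Holds 3 (D.map fun X => X.2.card)
  holds_four : σ.Holds 4 (D.flatMap fun X => X.1.sort.map Fin.val)
  holds_five : σ.Holds 5 (D.flatMap fun X => X.2.sort.map Fin.val)
  holds_six : σ.Holds 6 (D.flatMap fun X => entries A X.1.sort X.2.sort)

theorem Written.congr {m : ℕ} {A : Matrix (Fin m) (Fin m) Bool}
    {D : List (Finset (Fin m) × Finset (Fin m))} {σ σ' : Store} (h : Written A D σ)
    (hs : σ.SameExcept [2, 3, 11] [] σ') : Written A D σ' where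
  reg_zero := by rw [hs.1 _ (by simp), h.reg_zero]
  reg_seven := by rw [hs.1 _ (by simp), h.reg_seven]
  reg_eighteen := by rw [hs.1 _ (by simp), h.reg_eighteen]
  reg_nineteen := by rw [hs.1 _ (by simp), h.reg_nineteen]
  reg_seventeen := by rw [hs.1 _ (by simp), h.reg_seventeen]
  reg_eight := by rw [hs.1 _ (by simp), h.reg_eight]
  reg_nine := by rw [hs.1 _ (by simp), h.reg_nine]
  reg_ten := by rw [hs.1 _ (by simp), h.reg_ten]
  matrix := fun s t => by rw [hs.2 _ (by simp), h.matrix]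
  holds_two := h.holds_two.congr (hs.2 _ (by simp))
  holds_three := h.holds_three.congr (hs.2 _ (by simp))
  holds_four := h.holds_four.congr (hs.2 _ (by simp))
  holds_five := h.holds_five.congr (hs.2 _ (by simp))
  holds_six := h.holds_six.congr (hs.2 _ (by simp))

theorem Written.setReg {m : ℕ} {A : Matrix (Fin m) (Fin m) Bool}
    {D : List (Finset (Fin m) × Finset (Fin m))} {σ : Store} (h : Written A D σ) {r : ℕ}
    (hr : r ∈ [2, 3, 11]) (v : ℕ) : Written A D (σ.setReg r v) := by
  refine h.congr ⟨fun r' hr' => ?_, fun _ _ => rfl⟩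
  rw [Store.setReg_reg, if_neg fun h' : r' = r => hr' (h' ▸ hr)]

/-- Write the piece of the block whose number is in the register `3`. -/
def writePiece : Prog :=
  .seq (listBlock 4 8 3 2 12) <|
  .seq findSibling <|
  .seq (listBlock 5 9 4 3 13) <|
  .seq emit (.arith .add 17 17 7)

theorem Ends.writePiece {W m w b : ℕ} {A : Matrix (Fin m) (Fin m) Bool}
    {D : List (Finset (Fin m) × Finset (Fin m))} {σ : Store} (h : Written A D σ)
    (h2 : σ.reg 2 = w) (h3 : σ.reg 3 = b) (hb : b ≤ m) (hWm : 3 * (m ^ 2 + 1) ≤ W)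
    (hW : totalWeight (D ++ [(dyadicBlock m w b, dyadicBlock m w (sibling b))]) ≤ W) :
    Ends W writePiece σ
      (30 * pieceWeight (dyadicBlock m w b, dyadicBlock m w (sibling b))) fun σ' =>
      Written A (D ++ [(dyadicBlock m w b, dyadicBlock m w (sibling b))]) σ' ∧
        σ'.reg 2 = w ∧ σ'.reg 3 = b ∧ σ'.reg 11 = σ.reg 11 := by
  set S := dyadicBlock m w b with hS
  set T := dyadicBlock m w (sibling b) with hT
  have hSb : S.sort.map Fin.val = blockList m w b := map_val_sort_dyadicBlock m w b
  have hTb : T.sort.map Fin.val = blockList m w (sibling b) := map_val_sort_dyadicBlock m w _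
  have hSl : (blockList m w b).length = S.card := by rw [← hSb]; simp
  have hTl : (blockList m w (sibling b)).length = T.card := by rw [← hTb]; simp
  have hSm := card_le_of_finset_fin S
  have hTm := card_le_of_finset_fin T
  have hmm : m ≤ m ^ 2 := Nat.le_self_pow (by norm_num) m
  rw [totalWeight_append, totalWeight_singleton] at hW
  -- All pointers are bounded by the total weight, so they fit into a word.
  have l0 := length_le_totalWeight D
  have l4 := length_flatMap_le_totalWeight D (fun X => X.1.sort.map Fin.val) fun X => by
    have := card_le_of_finset_fin X.1
    simp [pieceWeight]
    omega
  have l5 := length_flatMap_le_totalWeight D (fun X => X.2.sort.map Fin.val) fun X => by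
    have := card_le_of_finset_fin X.2
    simp [pieceWeight]
    omega
  have l6 := length_flatMap_le_totalWeight D (fun X => entries A X.1.sort X.2.sort) fun X => by
    simp [pieceWeight, entries, List.length_flatMap]
  simp only [pieceWeight] at hW ⊢
  have eL : ∀ {α : Type} (f : Finset (Fin m) × Finset (Fin m) → List α),
      (D ++ [(S, T)]).flatMap f = D.flatMap f ++ f (S, T) := fun f => by
    rw [List.flatMap_append, List.flatMap_singleton]
  have hA := h.matrix
  refine Ends.seq (T₁ := 7 * m + 5) (by omega) (Ends.mono (Ends.listBlock h.reg_zero h2 h.reg_seven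
    h.reg_eighteen h3 h.holds_four h.reg_eight h.holds_two (by simpa using h.reg_seventeen)
    (by simp) (by simp) (by simp) (by simp) (by omega)) le_rfl ?_)
  rintro σ₁ ⟨u4, u8, u12, u2, us, usa⟩
  refine Ends.seq (T₁ := 5) (by omega) (Ends.mono (Ends.findSibling (b := b)
    (by rw [us 3 (by simp), h3]) (by rw [us 7 (by simp), h.reg_seven])
    (by rw [us 19 (by simp), h.reg_nineteen]) (by omega)) le_rfl ?_)
  rintro σ₂ rfl
  refine Ends.seq (T₁ := 7 * m + 5) (by omega) (Ends.mono (Ends.listBlock (m := m) (w := w)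
    (b := sibling b)
    (by simp [us 0, h.reg_zero]) (by simp [us 2, h2]) (by simp [us 7, h.reg_seven])
    (by simp [us 18, h.reg_eighteen]) (by simp) (h.holds_five.congr (by simp [usa 5]))
    (by simp [us 9, h.reg_nine]) (h.holds_three.congr (by simp [usa 3]))
    (by simp [us 17, h.reg_seventeen]) (by simp) (by simp) (by simp) (by simp) (by omega))
    le_rfl ?_)
  rintro σ₃ ⟨v5, v9, v13, v3, vs, vsa⟩
  have w0 : σ₃.reg 0 = m := by rw [vs 0 (by simp)]; simp [us 0, h.reg_zero]
  have w2 : σ₃.reg 2 = w := by rw [vs 2 (by simp)]; simp [us 2, h2]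
  have w3 : σ₃.reg 3 = b := by rw [vs 3 (by simp)]; simp [us 3, h3]
  have w7 : σ₃.reg 7 = 1 := by rw [vs 7 (by simp)]; simp [us 7, h.reg_seven]
  have w8 := (vs 8 (by simp)).trans ((by simp : _ = σ₁.reg 8).trans u8)
  have w10 := (vs 10 (by simp)).trans ((by simp [us 10] : _ = σ.reg 10).trans h.reg_ten)
  have w11 : σ₃.reg 11 = σ.reg 11 := by rw [vs 11 (by simp)]; simp [us 11]
  have w12 := (vs 12 (by simp)).trans ((by simp : _ = σ₁.reg 12).trans u12)
  have w17 : σ₃.reg 17 = D.length := by rw [vs 17 (by simp)]; simp [us 17, h.reg_seventeen]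
  have w18 : σ₃.reg 18 = 0 := by rw [vs 18 (by simp)]; simp [us 18, h.reg_eighteen]
  have w19 : σ₃.reg 19 = 2 := by rw [vs 19 (by simp)]; simp [us 19, h.reg_nineteen]
  have x1 : HoldsMatrix A σ₃ := fun s t => by
    rw [vsa 1 (by simp)]
    simpa [usa 1] using hA s t
  have x2 := u2.congr (σ' := σ₃) (by rw [vsa 2 (by simp)]; simp)
  have x4 := u4.congr (σ' := σ₃) (by rw [vsa 4 (by simp)]; simp)
  have x6 := h.holds_six.congr (σ' := σ₃) (by rw [vsa 6 (by simp)]; simp [usa 6])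
  rw [← hSb] at x4 w8
  rw [← hTb] at v5 v9
  rw [hSl] at x2
  rw [hTl] at v3
  refine Ends.seq (T₁ := 7 * (S.card * T.card) + 6 * S.card + 1) (by omega) (Ends.mono
    (Ends.emit (S := S.sort) (T := T.sort) w0 w7 w18 w12 w8 v13 v9 w10 x1 x4 v5 x6
      (by rw [← sq]; omega)
      (by simp only [List.length_append, List.length_map, Finset.length_sort] at *; omega)
      (by simp only [List.length_append, List.length_map, Finset.length_sort] at *; omega)
      (by simp only [Finset.length_sort]; omega))
    (by simp) ?_)
  rintro σ₄ ⟨y6, y10, ys, ysa⟩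
  have y17 : σ₄.reg 17 = D.length := by rw [ys 17 (by simp), w17]
  have y7 : σ₄.reg 7 = 1 := by rw [ys 7 (by simp), w7]
  refine Ends.arith (D.length + 1) (by simp [Op.eval, y17, y7]) (by omega) (by omega)
    ⟨⟨?_, ?_, ?_, ?_, ?_, ?_, ?_, ?_, ?_, ?_, ?_, ?_, ?_, ?_⟩, ?_, ?_, ?_⟩
  · simp [ys 0, w0]
  · simp [y7]
  · simp [ys 18, w18]
  · simp [ys 19, w19]
  · simp
  · rw [eL]
    simpa [ys 8] using w8
  · rw [eL]
    simpa [ys 9] using v9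
  · rw [eL]
    simpa using y10
  · intro s t
    simpa [ysa 1] using x1 s t
  · simpa using x2.congr (σ' := σ₄.setReg 17 _) (by simp [ysa 2])
  · simpa using v3.congr (σ' := σ₄.setReg 17 _) (by simp [ysa 3])
  · rw [eL]
    exact x4.congr (by simp [ysa 4])
  · rw [eL]
    exact v5.congr (by simp [ysa 5])
  · rw [eL]
    exact y6.congr rfl
  · simp [ys 2, w2]
  · simp [ys 3, w3]
  · simp [ys 11, w11]

/-- Write the pieces of the block length in the register `2`, and double the block length. -/
def writeLevel : Prog :=
  .seq (.const 3 0) <|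
  .seq (.arith .div 11 0 2) <|
  .seq (.arith .add 11 11 7) <|
  .seq (.loop 3 11 (.seq writePiece (.arith .add 3 3 7))) (.arith .add 2 2 2)

theorem Ends.writeLevel {W m w : ℕ} {A : Matrix (Fin m) (Fin m) Bool}
    {D : List (Finset (Fin m) × Finset (Fin m))} {σ : Store} (h : Written A D σ)
    (h2 : σ.reg 2 = w) (hwm : w ≤ m) (hWm : 3 * (m ^ 2 + 1) ≤ W)
    (hW : totalWeight (D ++ dyadicPieces m w) ≤ W) :
    Ends W writeLevel σ (40 * totalWeight (dyadicPieces m w) + 5) fun σ' =>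
      Written A (D ++ dyadicPieces m w) σ' ∧ σ'.reg 2 = 2 * w := by
  have hmm : m ≤ m ^ 2 := Nat.le_self_pow (by norm_num) m
  have hdiv : m / w ≤ m := Nat.div_le_self m w
  refine Ends.seq (T₁ := 1) (by omega) (Ends.const (Nat.zero_le _) le_rfl ?_)
  refine Ends.seq (T₁ := 1) (by omega) (Ends.arith (m / w) (by simp [Op.eval, h.reg_zero, h2])
    (by omega) le_rfl ?_)
  refine Ends.seq (T₁ := 1) (by omega) (Ends.arith (m / w + 1) (by simp [Op.eval, h.reg_seven])
    (by omega) le_rfl ?_)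
  let P : ℕ → List (Finset (Fin m) × Finset (Fin m)) := fun k =>
    (List.range k).map fun b => (dyadicBlock m w b, dyadicBlock m w (sibling b))
  have hP : ∀ k, P (k + 1) = P k ++ [(dyadicBlock m w k, dyadicBlock m w (sibling k))] :=
    fun k => by simp [P, List.range_succ]
  have hPw : ∀ k, totalWeight (P (k + 1)) = totalWeight (P k) +
      pieceWeight (dyadicBlock m w k, dyadicBlock m w (sibling k)) := fun k => by
    rw [hP, totalWeight_append, totalWeight_singleton]
  have hmono : Monotone fun k => totalWeight (P k) :=
    monotone_nat_of_le_succ fun k => by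
      rw [hPw]
      exact Nat.le_add_right _ _
  have hP0 : totalWeight (P 0) = 0 := rfl
  have hPn : P (m / w + 1) = dyadicPieces m w := rfl
  -- A weight is at least `1`, so raising the factor from `30` to `40` pays for the increment and
  -- the loop test of each round.
  refine Ends.seq (T₁ := 40 * totalWeight (dyadicPieces m w) + 1) (by omega) (Ends.mono (Ends.loop
    (N := m / w + 1) (fun k τ => Written A (D ++ P k) τ ∧ τ.reg 2 = w ∧ τ.reg 3 = k ∧
      τ.reg 11 = m / w + 1) (fun k => 40 * totalWeight (P k))
    (fun k => 30 * pieceWeight (dyadicBlock m w k, dyadicBlock m w (sibling k)) + 1)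
    (fun k _ => ?_) (fun k hk τ ht => by rw [ht.2.2.1, ht.2.2.2]; exact hk)
    (fun τ ht => by rw [ht.2.2.1, ht.2.2.2]; exact lt_irrefl _) (fun k hk τ ht => ?_)
    (by rw [hP0, hPn, Nat.mul_zero, Nat.add_zero]) ?_) le_rfl ?_)
  · rw [hPw, pieceWeight]
    omega
  · obtain ⟨tD, t2, t3, t11⟩ := ht
    have hWk : totalWeight (D ++ P (k + 1)) ≤ W := by
      refine le_trans ?_ hW
      rw [totalWeight_append, totalWeight_append, ← hPn]
      exact Nat.add_le_add_left (hmono hk) _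
    rw [hP, ← List.append_assoc] at hWk
    refine Ends.seq (Nat.le_succ _) (Ends.mono (Ends.writePiece tD t2 t3 (by omega) hWm hWk)
      le_rfl ?_)
    rintro τ' ⟨gD, g2, g3, g11⟩
    refine Ends.arith (k + 1) (by simp [Op.eval, g3, gD.reg_seven]) (by omega) (by omega)
      ⟨?_, by simp [g2], by simp, by simp [g11, t11]⟩
    rw [hP, ← List.append_assoc]
    exact gD.setReg (by simp) _
  · refine ⟨?_, by simp [h2], by simp, by simp⟩
    have : D ++ P 0 = D := by simp [P]
    rw [this]
    exact ((h.setReg (by simp) _).setReg (by simp) _).setReg (by simp) _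
  · rintro τ ⟨tD, t2, -, -⟩
    exact Ends.arith (2 * w) (by simp [Op.eval, t2, two_mul]) (by omega) (by omega)
      ⟨tD.setReg (by simp) _, by simp⟩

/-- Write all pieces of the dyadic partition. -/
def writePartition : Prog :=
  .seq (.const 2 1) <|
  .seq (.const 7 1) <|
  .seq (.const 18 0) <|
  .seq (.const 19 2) <|
  .seq (.loop 2 0 writeLevel) (.arith .add 0 17 18)

/-- Row-major addressing; it shows that the input array holds the matrix in the form that `emit`
reads. -/
theorem getD_entries {m : ℕ} (A : Matrix (Fin m) (Fin m) Bool) (S T : List (Fin m)) {i j : ℕ}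
    (hi : i < S.length) (hj : j < T.length) :
    (entries A S T).getD (i * T.length + j) 0 = (A S[i] T[j]).toNat := by
  induction S generalizing i with
  | nil => simp at hi
  | cons s S ih =>
    have he : entries A (s :: S) T = (T.map fun t => (A s t).toNat) ++ entries A S T := rfl
    rw [he]
    cases i with
    | zero =>
      rw [zero_mul, zero_add, List.getD_append _ _ _ _ (by simpa using hj)]
      simp [hj]
    | succ i =>
      rw [List.getD_append_right _ _ _ _ (by simp [add_mul]; omega)]
      have : (i + 1) * T.length + j - (T.map fun t => (A s t).toNat).length =
          i * T.length + j := by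
        rw [List.length_map, add_mul]
        omega
      rw [this, ih (by simpa using hi)]
      simp

theorem Ends.writePartition {m ℓ : ℕ} (c : Fin m → Fin ℓ) (A : Matrix (Fin m) (Fin m) Bool)
    {W : ℕ} (hW : 10 * (m ^ 2 + 1) ≤ W) :
    Ends W writePartition (input c A) (460 * m ^ 2 + 6)
      (IsOutput A (dyadicPartition m)) := by
  have hmm : m ≤ m ^ 2 := Nat.le_self_pow (by norm_num) m
  refine Ends.seq (T₁ := 1) (by omega) (Ends.const (by omega) le_rfl ?_)
  refine Ends.seq (T₁ := 1) (by omega) (Ends.const (by omega) le_rfl ?_)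
  refine Ends.seq (T₁ := 1) (by omega) (Ends.const (by omega) le_rfl ?_)
  refine Ends.seq (T₁ := 1) (by omega) (Ends.const (by omega) le_rfl ?_)
  let P : ℕ → List (Finset (Fin m) × Finset (Fin m)) := fun n =>
    (List.range n).flatMap fun k => dyadicPieces m (2 ^ k)
  have hP : ∀ k, P (k + 1) = P k ++ dyadicPieces m (2 ^ k) :=
    fun k => by simp [P, List.range_succ]
  have hPw : ∀ k, totalWeight (P (k + 1)) = totalWeight (P k) +
      totalWeight (dyadicPieces m (2 ^ k)) := fun k => by
    rw [hP, totalWeight_append]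
  have hmono : Monotone fun k => totalWeight (P k) :=
    monotone_nat_of_le_succ fun k => by
      rw [hPw]
      exact Nat.le_add_right _ _
  have hP0 : totalWeight (P 0) = 0 := rfl
  have hPn : P (Nat.clog 2 m) = dyadicPartition m := rfl
  have htot := totalWeight_dyadicPartition_le m
  -- Every scale has a piece, so the six overhead steps per scale turn the factor `40` into `46`;
  -- the total weight `10 * m ^ 2` then gives `460 * m ^ 2`.
  have hone : ∀ k, 1 ≤ totalWeight (dyadicPieces m (2 ^ k)) := fun k => by
    refine le_trans ?_ (length_le_totalWeight _)
    simp [dyadicPieces]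
  refine Ends.seq (T₁ := 460 * m ^ 2 + 1) (by omega) (Ends.mono (Ends.loop
    (N := Nat.clog 2 m) (fun k τ => Written A (P k) τ ∧ τ.reg 2 = 2 ^ k)
    (fun k => 46 * totalWeight (P k))
    (fun k => 40 * totalWeight (dyadicPieces m (2 ^ k)) + 5)
    (fun k _ => ?_) (fun k hk τ ht => ?_) (fun τ ht => ?_) (fun k hk τ ht => ?_)
    (by simp only [hP0, hPn]; omega) ?_) le_rfl ?_)
  · have := hone k
    rw [hPw]
    omega
  · rw [ht.2, ht.1.reg_zero]
    exact Nat.pow_lt_of_lt_clog hk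
  · rw [ht.2, ht.1.reg_zero, not_lt]
    exact Nat.le_pow_clog (by norm_num) m
  · rw [hP, pow_succ, mul_comm (2 ^ k)]
    refine Ends.writeLevel ht.1 ht.2 (Nat.pow_lt_of_lt_clog hk).le (by omega) ?_
    rw [← hP]
    exact (hmono hk).trans (by simp only [hPn]; omega)
  · refine ⟨?_, by simp⟩
    have : P 0 = [] := rfl
    rw [this]
    refine ⟨?_, ?_, ?_, ?_, ?_, ?_, ?_, ?_, fun s t => ?_, ?_, ?_, ?_, ?_, ?_⟩ <;>
      try simp [input, Store.Holds]
    have := getD_entries A (List.finRange m) (List.finRange m) (i := s) (j := t) (by simp)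
      (by simp)
    simpa [List.getD_eq_getElem?_getD] using this
  · rintro τ ⟨tD, -⟩
    rw [hPn] at tD
    have hl := length_le_totalWeight (dyadicPartition m)
    exact Ends.arith (dyadicPartition m).length
      (by simp [Op.eval, tD.reg_seventeen, tD.reg_eighteen]) (by omega) (by omega)
      ⟨by simp, tD.holds_two.congr rfl, tD.holds_three.congr rfl, tD.holds_four.congr rfl,
        tD.holds_five.congr rfl, tD.holds_six.congr rfl⟩

end RAM

/-! ### The main theorem -/

theorem mainTheorem4 :
    ∃ (part : ∀ m ℓ : ℕ, (Fin m → Fin ℓ) → List (Finset (Fin m) × Finset (Fin m)))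
      (prog : RAM.Prog),
    ∀ ℓ : ℕ, ∃ K : ℕ, ∀ (m : ℕ) (c : Fin m → Fin ℓ),
      (∀ i, (c ⁻¹' {i}).OrdConnected) →
      (∀ s t : Fin m, s ≠ t →
        ∃! j : Fin (part m ℓ c).length,
          s ∈ ((part m ℓ c).get j).1 ∧ t ∈ ((part m ℓ c).get j).2) ∧
      (∀ (V E : Type*) [Finite V] [Finite E] (G : PlaneDigraph V E)
        (C : Fin ℓ → Set ℂ) (u : Fin m → V) (A : Matrix (Fin m) (Fin m) Bool),
        (∀ i, G.IsSeparatorCurve (C i)) →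
        (∀ i j, i ≠ j → Disjoint (C i) (C j)) →
        Function.Injective u →
        (∀ i, ListedAlong (C i) (c ⁻¹' {i}) (fun x => G.pos (u x))) →
        G.IsReachMatrix u A →
        ∀ X ∈ part m ℓ c, ∀ s ∈ X.1, AtMostBlocks K (activeCols A X.1 X.2) (A s)) ∧
      (∀ s : Fin m, ((part m ℓ c).countP (fun X => s ∈ X.1) : ℝ) ≤ K * Real.log m) ∧
      (∀ t : Fin m, ((part m ℓ c).countP (fun X => t ∈ X.2) : ℝ) ≤ K * Real.log m) ∧
      (∀ A : Matrix (Fin m) (Fin m) Bool, ∃ (T : ℕ) (σ : RAM.Store),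
        T ≤ K * (m ^ 2 + 1) ∧
        RAM.Runs (K * (m ^ 2 + 1)) prog (RAM.input c A) T σ ∧
        RAM.IsOutput A (part m ℓ c) σ) := by
  -- One constant serves all bounds: `ℓ * 2 ^ ℓ` for the blocks, and `466` for the running time `460
  -- * m ^ 2 + 6`, the word size and the logarithmic factor `4`.
  refine ⟨fun m _ _ => dyadicPartition m, RAM.writePartition, fun ℓ =>
    ⟨ℓ * 2 ^ ℓ + 466, fun m c hc => ⟨fun s t => existsUnique_dyadicPartition, ?_, fun s => ?_,
      fun t => ?_, fun A => ?_⟩⟩⟩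
  · intro V E _ _ G C u A hC hd _ hl hA X hX s _
    exact (hA.atMostBlocks hc hC hd hl (separated_of_mem_dyadicPartition hX) s).mono
      (Nat.le_add_right _ _)
  · refine (countP_dyadicPartition_row m s).trans
      (mul_le_mul_of_nonneg_right ?_ (Real.log_natCast_nonneg m))
    exact_mod_cast (show 4 ≤ ℓ * 2 ^ ℓ + 466 by omega)
  · refine (countP_dyadicPartition_col m t).trans
      (mul_le_mul_of_nonneg_right ?_ (Real.log_natCast_nonneg m))
    exact_mod_cast (show 4 ≤ ℓ * 2 ^ ℓ + 466 by omega)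
  · have hK : 466 * (m ^ 2 + 1) ≤ (ℓ * 2 ^ ℓ + 466) * (m ^ 2 + 1) :=
      Nat.mul_le_mul_right _ (Nat.le_add_left _ _)
    obtain ⟨T, σ, hT, hr, ho⟩ := RAM.Ends.writePartition c A
      (W := (ℓ * 2 ^ ℓ + 466) * (m ^ 2 + 1)) (by omega)
    exact ⟨T, σ, by omega, hr, ho⟩
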